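/- Write $\partial=\frac{d}{dz}$, $\vartheta=z\partial$. Let $L=\sum_{i=0}^{d}a_i\partial^i\in\mathbb{Q}(z)[\partial]$ with $a_d\neq 0$ and $d\geq 1$; the number $d$ is the order (or degree) of $L$, and $L^{\vee}=\sum_{i}(-1)^{d+i}\partial^i a_i$ is its dual. A power series $\sum_m A_mz^m\in\mathbb{Q}[[z]]$ is N-integral if there is an integer $N\geq 1$ with $N^mA_m\in\mathbb{Z}$ for all $m\ge 0$. A flag of $L$ at $z=0$ is a basis $y_0,\dots,y_{d-1}$ of solutions of $L$ of the form $y_k=\sum_{j=0}^k\frac{1}{j!}\ln(z)^jf_{k-j}$ with $f_0,\dots,f_{d-1}\in\mathbb{Q}((z))$ and $z^{-r}f_0\in 1+z\mathbb{Q}[[z]]$ for some $r\in\mathbb{Z}$. For a flag put $\mathcal{N}_0=1$ and $\mathcal{N}_{k+1}=\vartheta\,\frac{1}{\mathcal{N}_k(y_k)}\,\mathcal{N}_k$. The structure series of $L$ are $\alpha_i=\mathcal{N}_i(y_i)^{-1}$, $1\leq i\leq d-1$ (they do not depend on the flag). If $d\ge 2$, the special coordinate of $L$ is the power series $q\in\mathbb{Q}[[z]]$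 with $q(0)=0$, $q'(0)=1$ and $\vartheta q=\alpha_1^{-1}q$. The operator $L$ is of CY-type if it is irreducible in $\mathbb{Q}(z)[\partial]$ and - (P) $L\alpha=\alpha L^{\vee}$ for some $0\neq\alpha\in\mathbb{Q}(z)$; - (M) $z=0$ is a regular point or a regular singularity of $L$, and all exponents of $L$ at $z=0$ are equal to one integer; - (N) $L$ has a nonzero N-integral solution $y\in\mathbb{Q}[[z]]$; - (Q) if $d\geq 2$, the special coordinate of $L$ exists and is N-integral; - (S) all structure series $\alpha_1,\dots,\alpha_{d-1}$ of $L$ exist and are N-integral power series. For $n\ge 0$, the symmetric power $\mathrm{Sym}^n(L)$ is the minimal operator of $e^n\in\mathrm{Sym}^n(M_L)$, that is, the monic operator of least order which annihilates $e^n$, where $M_L=\mathbb{Q}(z)[\partial]/\mathbb{Q}(z)[\partial]L$ and $e\in M_L$ is the class of $1$. **Proposition.** Let $L$ be a CY-type operator of degree two and $n\ge 0$. Then $\mathrm{Sym}^n(L)$ is a CY-type operator of degree $n+1$. All its structure series $\alpha_1,\dots,\alpha_n$ are equal and, if $n\geq 1$, it has the same special coordinate as $L$. -/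

import Mathlib

noncomputable section

namespace CalabiYauOp

/-- The derivation `d/dz` of the field `ℚ(z)`, by the quotient rule. -/
def ratDeriv (f : RatFunc ℚ) : RatFunc ℚ :=
  algebraMap (Polynomial ℚ) (RatFunc ℚ)
      (Polynomial.derivative f.num * f.denom - f.num * Polynomial.derivative f.denom) /
    algebraMap (Polynomial ℚ) (RatFunc ℚ) (f.denom ^ 2)

open scoped RatFunc in
/-- The embedding `ℚ(z) → ℚ((z))`, the Laurent expansion at `z = 0`. -/
def toLaurent : RatFunc ℚ →+* LaurentSeries ℚ := algebraMap (RatFunc ℚ) (LaurentSeries ℚ)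

/-! ### The ring `ℚ(z)[∂]` of differential operators -/

/-- Differential operators `∑ aᵢ ∂ⁱ` with `aᵢ ∈ ℚ(z)`, coded by their coefficients: the polynomial
variable stands for `∂ = d/dz`, and `natDegree` is the order. The product of operators is not the
product of polynomials but `DiffOp.comp` below. -/
abbrev DiffOp : Type := Polynomial (RatFunc ℚ)

namespace DiffOp

/-- The product `∂ · Q`, by the rule `∂ · b ∂ʲ = b' ∂ʲ + b ∂ʲ⁺¹`. -/
def dMul (Q : DiffOp) : DiffOp :=
  Q.sum fun j b => Polynomial.monomial j (ratDeriv b) + Polynomial.monomial (j + 1) b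

/-- The product `P · Q` in `ℚ(z)[∂]`: `(∑ aᵢ ∂ⁱ) · Q = ∑ aᵢ (∂ⁱ · Q)`. -/
def comp (P Q : DiffOp) : DiffOp :=
  P.sum fun i a => Polynomial.C a * dMul^[i] Q

/-- The value `P(x) = ∑ aᵢ Dⁱ(x)` of the operator `P` at an element `x` of a ring `A` with
derivation `D`, where `ℚ(z)` maps to `A` by `φ`. -/
def apply {A : Type*} [CommRing A] (φ : RatFunc ℚ →+* A) (D : A → A) (P : DiffOp) (x : A) : A :=
  P.sum fun i a => φ a * D^[i] x

/-- Irreducibility in `ℚ(z)[∂]`: positive order, and no factorisation into two operators of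
positive order (the units of `ℚ(z)[∂]` are the operators of order zero other than `0`). -/
def IsIrreducible (L : DiffOp) : Prop :=
  0 < L.natDegree ∧ ∀ A B : DiffOp, comp A B = L → A.natDegree = 0 ∨ B.natDegree = 0

/-- The dual `L^∨ = ∑ (-1)^(d+i) ∂ⁱ aᵢ` of an operator `L = ∑ aᵢ ∂ⁱ` of order `d`. -/
def dual (L : DiffOp) : DiffOp :=
  L.sum fun i a =>
    (-1 : DiffOp) ^ (L.natDegree + i) * comp (Polynomial.monomial i 1) (Polynomial.C a)

/-- `L α = α L^∨` for some nonzero `α ∈ ℚ(z)`. -/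
def IsSelfDual (L : DiffOp) : Prop :=
  ∃ α : RatFunc ℚ, α ≠ 0 ∧ comp L (Polynomial.C α) = comp (Polynomial.C α) (dual L)

/-! ### Exponents at `z = 0` -/

/-- The Laurent expansion at `z = 0` of the `i`-th coefficient of the monic operator obtained from
`L` by dividing by its leading coefficient. -/
def monicCoeff (L : DiffOp) (i : ℕ) : LaurentSeries ℚ :=
  toLaurent (L.coeff i / L.leadingCoeff)

/-- `z = 0` is a regular point or a regular singularity of `L`: the `i`-th coefficient of the monic
operator of order `d` has a pole of order at most `d - i`. -/
def IsRegularSingularAtZero (L : DiffOp) : Prop :=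
  ∀ i ≤ L.natDegree, ∀ m : ℤ, m < (i : ℤ) - L.natDegree → (L.monicCoeff i).coeff m = 0

/-- The indicial polynomial at `z = 0` of an operator `L` of order `d`, namely
`∑ᵢ cᵢ T (T - 1) ⋯ (T - i + 1)` with `cᵢ` the coefficient of `z^(i-d)` in the `i`-th coefficient
of the monic operator. Its roots are the exponents of `L` at `z = 0`. -/
def indicial (L : DiffOp) : Polynomial ℚ :=
  ∑ i ∈ Finset.range (L.natDegree + 1),
    Polynomial.C ((L.monicCoeff i).coeff ((i : ℤ) - L.natDegree)) * descPochhammer ℚ i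

/-- All exponents of `L` at `z = 0` are equal to one and the same integer. -/
def HasEqualIntegralExponents (L : DiffOp) : Prop :=
  L.IsRegularSingularAtZero ∧
    ∃ r : ℤ, L.indicial = (Polynomial.X - Polynomial.C (r : ℚ)) ^ L.natDegree

/-! ### Symmetric powers -/

/-- The differential module `M_L = ℚ(z)[∂]/ℚ(z)[∂]L` of an operator `L` of order `d` has the
`ℚ(z)`-basis `e, ∂e, …, ∂^(d-1)e`, where `e` is the class of `1`. Its symmetric algebra is the
polynomial ring in these basis elements, the variable `Xᵢ` standing for `∂ⁱe`. -/
abbrev SymAlg (L : DiffOp) : Type := MvPolynomial (Fin L.natDegree) (RatFunc ℚ)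

/-- The derivation of the symmetric algebra of `M_L` that extends `d/dz` on `ℚ(z)` and `∂` on
`M_L`: it sends `∂ⁱe` to `∂ⁱ⁺¹e`, where `∂ᵈe = -∑ (aⱼ/a_d) ∂ʲe`. -/
def symDeriv (L : DiffOp) (p : L.SymAlg) : L.SymAlg :=
  (∑ m ∈ p.support, MvPolynomial.monomial m (ratDeriv (p.coeff m))) +
    MvPolynomial.mkDerivation (RatFunc ℚ)
      (fun i : Fin L.natDegree =>
        if h : (i : ℕ) + 1 < L.natDegree then (MvPolynomial.X ⟨i + 1, h⟩ : L.SymAlg)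
        else -∑ j : Fin L.natDegree,
          MvPolynomial.C (L.coeff j / L.leadingCoeff) * MvPolynomial.X j) p

/-- The marked element `e` of `M_L`, the class of `1` (which is `0` if `L` has order zero). -/
def marked (L : DiffOp) : L.SymAlg :=
  if h : 0 < L.natDegree then MvPolynomial.X ⟨0, h⟩ else 0

/-- `P` is the minimal operator of an element `x` of the symmetric algebra: the monic operator of
least order that annihilates `x`. There is at most one, as the difference of two would annihilate
`x` and have smaller order. -/
def IsMinimalOperator (L : DiffOp) (x : L.SymAlg) (P : DiffOp) : Prop :=
  P.Monic ∧ apply MvPolynomial.C L.symDeriv P x = 0 ∧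
    ∀ Q : DiffOp, Q ≠ 0 → apply MvPolynomial.C L.symDeriv Q x = 0 → P.natDegree ≤ Q.natDegree

open Classical in
/-- The symmetric power `Symⁿ(L)`: the minimal operator of the element `e ⋯ e = eⁿ` of the
differential module `Symⁿ(M_L)`, the degree `n` part of the symmetric algebra of `M_L`.
It always exists, as `Symⁿ(M_L)` has finite dimension; `0` is a dummy value. -/
def symPower (n : ℕ) (L : DiffOp) : DiffOp :=
  if h : ∃ P, IsMinimalOperator L (L.marked ^ n) P then h.choose else 0

end DiffOp

/-! ### Local solutions at `z = 0`, flags and structure series -/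

/-- A power series `∑ Aₘ zᵐ` over `ℚ` is N-integral if there is an integer `N ≥ 1` with
`Nᵐ Aₘ ∈ ℤ` for all `m`. -/
def NIntegral (y : PowerSeries ℚ) : Prop :=
  ∃ N : ℕ, 0 < N ∧ ∀ m : ℕ, ∃ k : ℤ, (N : ℚ) ^ m * PowerSeries.coeff m y = k

/-- The ring `ℚ((z))[ln z]`: the polynomial variable stands for `ln z`. -/
abbrev LogSeries : Type := Polynomial (LaurentSeries ℚ)

/-- The derivation `d/dz` of `ℚ((z))[ln z]`: `(f lnʲ z)' = f' lnʲ z + j f z⁻¹ lnʲ⁻¹ z`. -/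
def logDeriv (y : LogSeries) : LogSeries :=
  y.sum fun j f => Polynomial.monomial j (LaurentSeries.derivative ℚ f) +
    Polynomial.monomial (j - 1) ((j : LaurentSeries ℚ) * HahnSeries.single (-1) 1 * f)

/-- The value `L(y)` of the operator `L` at an element `y` of `ℚ((z))[ln z]`. -/
def logApply (L : DiffOp) (y : LogSeries) : LogSeries :=
  L.apply (Polynomial.C.comp toLaurent) logDeriv y

/-- The derivation `ϑ = z d/dz` of `ℚ((z))[ln z]`. -/
def logTheta (y : LogSeries) : LogSeries :=
  Polynomial.C (HahnSeries.single 1 1) * logDeriv y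

/-- `yₖ = ∑_{j ≤ k} (1/j!) lnʲ(z) f_{k-j}`. -/
def flagSol (f : ℕ → LaurentSeries ℚ) (k : ℕ) : LogSeries :=
  ∑ j ∈ Finset.range (k + 1), Polynomial.monomial j (((j.factorial : ℚ)⁻¹) • f (k - j))

/-- The series `f₀, …, f_{d-1}` define a flag `y₀, …, y_{d-1}` of the operator `L` of order `d`:
`z^{-r} f₀ ∈ 1 + z ℚ⟦z⟧` for an integer `r`, and all the `yₖ` are solutions of `L`. These are
linearly independent, `yₖ` being of degree `k` in `ln z`, and so form a basis of the
solution space. The values `f k` for `k ≥ d` are irrelevant. -/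
def IsFlag (L : DiffOp) (f : ℕ → LaurentSeries ℚ) : Prop :=
  (∃ (r : ℤ) (u : PowerSeries ℚ), PowerSeries.constantCoeff u = 1 ∧
      f 0 = HahnSeries.single r 1 * HahnSeries.ofPowerSeries ℤ ℚ u) ∧
    ∀ k < L.natDegree, logApply L (flagSol f k) = 0

/-- The operators `𝒩₀ = 1` and `𝒩ₖ₊₁ = ϑ (1 / 𝒩ₖ(yₖ)) 𝒩ₖ`, acting on `ℚ((z))[ln z]`. For a flag
`y`, each `𝒩ₖ(yₖ)` is a unit of `ℚ((z))`. -/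
def normalOp (y : ℕ → LogSeries) : ℕ → LogSeries → LogSeries
  | 0, v => v
  | k + 1, v => logTheta (Ring.inverse (normalOp y k (y k)) * normalOp y k v)

/-- `α` is the `i`-th structure series `αᵢ = 𝒩ᵢ(yᵢ)⁻¹` of `L`, where `1 ≤ i < d` with `d` the order
of `L` and `y₀, …, y_{d-1}` is a flag of `L` at `z = 0`. -/
def IsStructureSeries (L : DiffOp) (i : ℕ) (α : PowerSeries ℚ) : Prop :=
  1 ≤ i ∧ i < L.natDegree ∧ ∃ f : ℕ → LaurentSeries ℚ, IsFlag L f ∧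
    Polynomial.C (HahnSeries.ofPowerSeries ℤ ℚ α) *
      normalOp (flagSol f) i (flagSol f i) = 1

/-- `q` is the special coordinate of `L` at `z = 0`: the solution `q = z + ⋯` of
`z q' = α₁⁻¹ q`, where `α₁` is the first structure series. -/
def IsSpecialCoordinate (L : DiffOp) (q : PowerSeries ℚ) : Prop :=
  PowerSeries.constantCoeff q = 0 ∧ PowerSeries.coeff 1 q = 1 ∧
    ∃ α : PowerSeries ℚ, IsStructureSeries L 1 α ∧
      α * (PowerSeries.X * PowerSeries.derivative ℚ q) = q

/-- Differential operators of CY-type. An operator of order one has neither structure series nor a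
special coordinate, so that the conditions (Q) and (S) are void for it. -/
structure IsCYType (L : DiffOp) : Prop where
  irreducible : L.IsIrreducible
  /-- property (P) -/
  selfDual : L.IsSelfDual
  /-- property (M) -/
  exponents : L.HasEqualIntegralExponents
  /-- property (N) -/
  solution : ∃ y : PowerSeries ℚ, y ≠ 0 ∧ NIntegral y ∧
    logApply L (Polynomial.C (HahnSeries.ofPowerSeries ℤ ℚ y)) = 0
  /-- property (Q) -/
  specialCoordinate : 2 ≤ L.natDegree → ∃ q, IsSpecialCoordinate L q ∧ NIntegral q
  /-- property (S) -/
  structureSeries : ∀ i, 1 ≤ i → i < L.natDegree → ∃ α, IsStructureSeries L i α ∧ NIntegral α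

end CalabiYauOp

end

/-!
Write `ϑ = z d/dz`, let `p` and `q` be the coefficients of the monic operator `∂² + p ∂ + q`
obtained from `L`, and let `f₀` and `f₀ τ` with `τ = ln z + g` be a flag of `L`.

*The operator.* Define `L₀ = 1`, `L₁ = ∂`, `Lᵢ₊₁ = (∂ + i p) Lᵢ + i (n - i + 1) q Lᵢ₋₁` (`symRec`).
Then `Lᵢ` maps `eⁿ` to a multiple of `eⁿ⁻ⁱ (∂e)ⁱ`, and `Lₙ₊₁` kills `eⁿ`. It is the minimal operator
(`symPower_eq`): under `e ↦ f₀ τ` an operator that kills `eⁿ` kills a function of degree `n` in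
`ln z`, and a nonzero operator of order `m` kills no nonzero function of degree `m` or more in
`ln z` (`natDegree_lt_of_lauApply_eq_zero`).

*Irreducibility.* This is where the usual argument invokes the differential Galois group, which
contains `SL₂`. The unipotent local monodromy is enough. If `Lₙ₊₁ = A B` with `B` of order `b`, the
degree bound applied to `A` shows that `B` kills `f₀ⁿ τᵇ⁻¹` (`symOp_isIrreducible`).
A conjugate of `B` with a power of `f₀` then kills `(f₀ τ)ᵇ⁻¹`, as does the symmetric power of `L`
of order `b`. By the degree bound the two operators are equal, and their second coefficients yield
`f₀' / f₀ ∈ ℚ(z)` (`exists_logDeriv_rational`), so that `L` has a right factor of order one.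

*Duality.* The operator `Lₙ₊₁` is a noncommutative continuant with the letters `∂ + i p`, and a
continuant may be expanded from either end (`continuant_reverse`). The adjoint reverses the letters;
conjugation with `wⁿ`, where `w` is the Wronskian of `L`, restores the original order
(`symOp_isSelfDual`). The Wronskian is rational because `L` is self-dual.

*Exponents.* The indicial polynomials of the `Lᵢ` obey the same recursion with constant
coefficients, and it is solved by the symmetric powers of `(ϑ - r)²` (`symRec_const`).

*Flags.* As all exponents are equal, the solutions in `ℚ((z))` form a line, so that the solutions of
degree less than `k` in `ln z` are spanned by the `f₀ⁿ τʲ` with `j < k`. Every flag therefore is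
triangular over `ℚ` with respect to the flag `f₀ⁿ τᵏ / k!`, and its structure series all are
`(ϑ τ)⁻¹`, for `L` and for its symmetric powers alike (`IsFrame.isStructureSeries_iff`). The special
coordinate depends on this series only.
-/

noncomputable section

namespace CalabiYauOp

/-! ### Differential operators over a differential field -/

section Operators

open Polynomial

variable {k A : Type*} [Field k] [CommRing A]

/-- `D` is a derivation of the ring `A`. A predicate on functions is used in place of Mathlib's
bundled derivations because the derivations at hand are given as functions, and because the
scalar actions on `ℚ((z))` come from several instances. -/
structure IsDer (D : A → A) : Prop where
  add : ∀ x y, D (x + y) = D x + D y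
  mul : ∀ x y, D (x * y) = x * D y + y * D x

namespace IsDer

variable {D : A → A}

lemma zero (hD : IsDer D) : D 0 = 0 := by
  have := hD.add 0 0
  rwa [add_zero, left_eq_add] at this

lemma one (hD : IsDer D) : D 1 = 0 := by
  have := hD.mul 1 1
  rwa [mul_one, one_mul, left_eq_add] at this

lemma neg (hD : IsDer D) (x : A) : D (-x) = -D x := by
  rw [eq_neg_iff_add_eq_zero, ← hD.add, neg_add_cancel, hD.zero]

lemma sub (hD : IsDer D) (x y : A) : D (x - y) = D x - D y := by
  rw [sub_eq_add_neg, hD.add, hD.neg, sub_eq_add_neg]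

lemma natCast (hD : IsDer D) (n : ℕ) : D n = 0 := by
  induction n with
  | zero => rw [Nat.cast_zero, hD.zero]
  | succ n ih => rw [Nat.cast_succ, hD.add, ih, hD.one, add_zero]

lemma const_mul (hD : IsDer D) {c : A} (hc : D c = 0) (x : A) : D (c * x) = c * D x := by
  rw [hD.mul, hc, mul_zero, add_zero]

lemma pow_succ (hD : IsDer D) (x : A) (n : ℕ) :
    D (x ^ (n + 1)) = (n + 1 : ℕ) * x ^ n * D x := by
  induction n with
  | zero => simp
  | succ n ih => rw [_root_.pow_succ x (n + 1), hD.mul, ih]; push_cast; ring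

lemma sum (hD : IsDer D) {ι : Type*} (s : Finset ι) (f : ι → A) :
    D (∑ i ∈ s, f i) = ∑ i ∈ s, D (f i) := by
  induction s using Finset.cons_induction with
  | empty => simp [hD.zero]
  | cons a s ha ih => rw [Finset.sum_cons, Finset.sum_cons, hD.add, ih]

lemma iterate_add (hD : IsDer D) (i : ℕ) (x y : A) : D^[i] (x + y) = D^[i] x + D^[i] y := by
  induction i generalizing x y with
  | zero => rfl
  | succ i ih => simp only [Function.iterate_succ_apply, hD.add, ih]

lemma iterate_const_mul (hD : IsDer D) (i : ℕ) {c : A} (hc : D c = 0) (x : A) :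
    D^[i] (c * x) = c * D^[i] x := by
  induction i generalizing x with
  | zero => rfl
  | succ i ih => rw [Function.iterate_succ_apply, hD.const_mul hc, ih, Function.iterate_succ_apply]

end IsDer

/-- The value `P(x) = ∑ φ(aᵢ) Dⁱ(x)` of an operator `P = ∑ aᵢ ∂ⁱ` over an arbitrary field; over
`ℚ(z)` this is `DiffOp.apply`. -/
def opEval (φ : k →+* A) (D : A → A) (P : k[X]) (x : A) : A :=
  P.sum fun i a => φ a * D^[i] x

/-- The product `∂ · Q` over an arbitrary field with derivation `d`; over `ℚ(z)` this is
`DiffOp.dMul`. -/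
def derivMul (d : k → k) (Q : k[X]) : k[X] :=
  Q.sum fun j b => monomial j (d b) + monomial (j + 1) b

/-- The product `P · Q` of operators over an arbitrary field with derivation `d`; over `ℚ(z)` this
is `DiffOp.comp`. -/
def opMul (d : k → k) (P Q : k[X]) : k[X] :=
  P.sum fun i a => C a * (derivMul d)^[i] Q

section Eval

variable (φ : k →+* A) (D : A → A)

lemma opEval_monomial (i : ℕ) (a : k) (x : A) :
    opEval φ D (monomial i a) x = φ a * D^[i] x := by
  simp [opEval, sum_monomial_index]

lemma opEval_zero (x : A) : opEval φ D 0 x = 0 := by simp [opEval]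

lemma opEval_add (P Q : k[X]) (x : A) :
    opEval φ D (P + Q) x = opEval φ D P x + opEval φ D Q x := by
  unfold opEval
  rw [sum_add_index] <;> simp [add_mul]

lemma opEval_C (a : k) (x : A) : opEval φ D (C a) x = φ a * x := by
  rw [← monomial_zero_left, opEval_monomial]; rfl

lemma opEval_C_mul (a : k) (P : k[X]) (x : A) :
    opEval φ D (C a * P) x = φ a * opEval φ D P x := by
  induction P using Polynomial.induction_on' with
  | add P Q hP hQ => rw [mul_add, opEval_add, opEval_add, hP, hQ, mul_add]
  | monomial i b => rw [C_mul_monomial, opEval_monomial, opEval_monomial, map_mul, mul_assoc]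

lemma opEval_neg (P : k[X]) (x : A) : opEval φ D (-P) x = -opEval φ D P x := by
  rw [eq_neg_iff_add_eq_zero, ← opEval_add, neg_add_cancel, opEval_zero]

lemma opEval_sub (P Q : k[X]) (x : A) :
    opEval φ D (P - Q) x = opEval φ D P x - opEval φ D Q x := by
  rw [sub_eq_add_neg, opEval_add, opEval_neg, sub_eq_add_neg]

lemma opEval_sum {ι : Type*} (s : Finset ι) (P : ι → k[X]) (x : A) :
    opEval φ D (∑ i ∈ s, P i) x = ∑ i ∈ s, opEval φ D (P i) x := by
  induction s using Finset.cons_induction with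
  | empty => simp [opEval_zero]
  | cons a s ha ih => rw [Finset.sum_cons, Finset.sum_cons, opEval_add, ih]

lemma opEval_eq_sum_range {P : k[X]} {m : ℕ} (hP : P.natDegree < m) (x : A) :
    opEval φ D P x = ∑ i ∈ Finset.range m, φ (P.coeff i) * D^[i] x := by
  rw [opEval, Polynomial.sum_over_range' _ _ m hP]
  simp

variable {D}

lemma opEval_apply_add (hD : IsDer D) (P : k[X]) (x y : A) :
    opEval φ D P (x + y) = opEval φ D P x + opEval φ D P y := by
  simp only [opEval, hD.iterate_add, mul_add, Polynomial.sum_def, Finset.sum_add_distrib]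

lemma opEval_const_mul (hD : IsDer D) (P : k[X]) {c : A} (hc : D c = 0) (x : A) :
    opEval φ D P (c * x) = c * opEval φ D P x := by
  simp only [opEval, hD.iterate_const_mul _ hc, mul_left_comm _ c, Polynomial.sum_def,
    Finset.mul_sum]

lemma opEval_apply_zero (hD : IsDer D) (P : k[X]) : opEval φ D P 0 = 0 := by
  have := opEval_const_mul φ hD P hD.zero 0
  simpa using this

lemma opEval_apply_neg (hD : IsDer D) (P : k[X]) (x : A) :
    opEval φ D P (-x) = -opEval φ D P x := by
  rw [eq_neg_iff_add_eq_zero, ← opEval_apply_add φ hD, neg_add_cancel, opEval_apply_zero φ hD]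

lemma opEval_apply_sub (hD : IsDer D) (P : k[X]) (x y : A) :
    opEval φ D P (x - y) = opEval φ D P x - opEval φ D P y := by
  rw [sub_eq_add_neg, opEval_apply_add φ hD, opEval_apply_neg φ hD, sub_eq_add_neg]

/-- A ring homomorphism that commutes with the derivations and with the embeddings of the
coefficient field commutes with every operator. -/
lemma map_opEval {B : Type*} [CommRing B] (ψ : A →+* B) {E : B → B}
    (h : ∀ x, ψ (D x) = E (ψ x)) (P : k[X]) (x : A) :
    ψ (opEval φ D P x) = opEval (ψ.comp φ) E P (ψ x) := by
  have hi : ∀ i x, ψ (D^[i] x) = E^[i] (ψ x) := by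
    intro i
    induction i with
    | zero => intro x; rfl
    | succ i ih => intro x; rw [Function.iterate_succ_apply, ih, h, Function.iterate_succ_apply]
  simp only [opEval, Polynomial.sum_def, map_sum, map_mul, hi, RingHom.comp_apply]

lemma opEval_map {k' : Type*} [Field k'] (ψ : k' →+* k) (P : k'[X]) (x : A) :
    opEval φ D (P.map ψ) x = opEval (φ.comp ψ) D P x := by
  induction P using Polynomial.induction_on' with
  | add P Q hP hQ => rw [Polynomial.map_add, opEval_add, opEval_add, hP, hQ]
  | monomial i b => rw [map_monomial, opEval_monomial, opEval_monomial]; rfl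

end Eval

variable {d : k → k}

lemma derivMul_add (hd : IsDer d) (P Q : k[X]) :
    derivMul d (P + Q) = derivMul d P + derivMul d Q := by
  unfold derivMul
  rw [sum_add_index]
  · intro j; rw [hd.zero, map_zero, map_zero, add_zero]
  · intro j a b; rw [hd.add, map_add, map_add]; abel

lemma derivMul_monomial (hd : IsDer d) (j : ℕ) (b : k) :
    derivMul d (monomial j b) = monomial j (d b) + monomial (j + 1) b := by
  unfold derivMul
  rw [sum_monomial_index]
  rw [hd.zero, map_zero, map_zero, add_zero]

lemma coeff_derivMul (hd : IsDer d) (Q : k[X]) (i : ℕ) :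
    (derivMul d Q).coeff i = (X * Q).coeff i + d (Q.coeff i) := by
  induction Q using Polynomial.induction_on' with
  | add P Q hP hQ =>
    rw [derivMul_add hd, coeff_add, hP, hQ, mul_add, coeff_add, coeff_add, hd.add]; ring
  | monomial j b =>
    rw [derivMul_monomial hd, X_mul_monomial, coeff_add, coeff_monomial, coeff_monomial,
      coeff_monomial]
    split_ifs <;> simp [add_comm, hd.zero]

section

variable (φ : k →+* A) {D : A → A}

lemma opEval_derivMul (hD : IsDer D) (hd : IsDer d) (hφ : ∀ a, D (φ a) = φ (d a)) (Q : k[X])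
    (x : A) : opEval φ D (derivMul d Q) x = D (opEval φ D Q x) := by
  induction Q using Polynomial.induction_on' with
  | add P Q hP hQ => rw [derivMul_add hd, opEval_add, opEval_add, hP, hQ, hD.add]
  | monomial j b =>
    rw [derivMul_monomial hd, opEval_add, opEval_monomial, opEval_monomial, opEval_monomial,
      hD.mul, hφ, Function.iterate_succ_apply']
    ring

lemma opEval_iterate_derivMul (hD : IsDer D) (hd : IsDer d) (hφ : ∀ a, D (φ a) = φ (d a)) (i : ℕ)
    (Q : k[X]) (x : A) : opEval φ D ((derivMul d)^[i] Q) x = D^[i] (opEval φ D Q x) := by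
  induction i with
  | zero => rfl
  | succ i ih => rw [Function.iterate_succ_apply', Function.iterate_succ_apply',
      opEval_derivMul φ hD hd hφ, ih]

lemma opEval_opMul (hD : IsDer D) (hd : IsDer d) (hφ : ∀ a, D (φ a) = φ (d a)) (P Q : k[X])
    (x : A) : opEval φ D (opMul d P Q) x = opEval φ D P (opEval φ D Q x) := by
  rw [opMul, Polynomial.sum_def, opEval_sum]
  simp only [opEval_C_mul, opEval_iterate_derivMul φ hD hd hφ]
  rfl

end

/-- An operator `Q` of order at most `m` has the same coefficient at `∂ᵐ` as `∂ⁱ Q` at `∂ᵐ⁺ⁱ`. -/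
lemma coeff_iterate_derivMul_top (hd : IsDer d) (Q : k[X]) (m : ℕ)
    (hQ : ∀ j, m < j → Q.coeff j = 0) (i : ℕ) :
    ((derivMul d)^[i] Q).coeff (m + i) = Q.coeff m ∧
      ∀ j, m + i < j → ((derivMul d)^[i] Q).coeff j = 0 := by
  induction i with
  | zero => exact ⟨rfl, hQ⟩
  | succ i ih =>
    simp only [Function.iterate_succ_apply', coeff_derivMul hd]
    refine ⟨?_, fun j hj => ?_⟩
    · rw [← add_assoc, coeff_X_mul, ih.1, ih.2 _ (by omega), hd.zero, add_zero]
    · obtain ⟨j, rfl⟩ : ∃ j', j = j' + 1 := ⟨j - 1, by omega⟩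
      rw [coeff_X_mul, ih.2 _ (by omega), ih.2 _ (by omega), hd.zero, add_zero]

/-- The second coefficient of `∂ⁱ g` for a function `g`. -/
lemma coeff_iterate_derivMul_C (hd : IsDer d) (g : k) (i : ℕ) :
    ((derivMul d)^[i + 1] (C g)).coeff i = (i + 1 : ℕ) * d g := by
  induction i with
  | zero => simp [coeff_derivMul hd]
  | succ i ih =>
    rw [Function.iterate_succ_apply', coeff_derivMul hd, coeff_X_mul, ih]
    have h := (coeff_iterate_derivMul_top hd (C g) 0 (fun j hj => by
      rw [coeff_C, if_neg (by omega)]) (i + 1)).1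
    rw [zero_add] at h
    rw [h]; simp; ring

lemma opMul_coeff (P Q : k[X]) (j : ℕ) :
    (opMul d P Q).coeff j =
      ∑ i ∈ Finset.range (P.natDegree + 1), P.coeff i * ((derivMul d)^[i] Q).coeff j := by
  rw [opMul, Polynomial.sum_over_range]
  · simp
  · simp

lemma opMul_natDegree (hd : IsDer d) {P Q : k[X]} (hP : P ≠ 0) (hQ : Q ≠ 0) :
    (opMul d P Q).natDegree = P.natDegree + Q.natDegree := by
  have ht := coeff_iterate_derivMul_top hd Q Q.natDegree
    (fun j hj => coeff_eq_zero_of_natDegree_lt hj)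
  have h1 : (opMul d P Q).coeff (P.natDegree + Q.natDegree) = P.leadingCoeff * Q.leadingCoeff := by
    rw [opMul_coeff, Finset.sum_range_succ, Finset.sum_eq_zero, zero_add, add_comm, (ht _).1]
    · rfl
    · intro i hi
      rw [Finset.mem_range] at hi
      rw [(ht i).2 _ (by omega), mul_zero]
  apply natDegree_eq_of_le_of_coeff_ne_zero
  · rw [natDegree_le_iff_coeff_eq_zero]
    intro j hj
    rw [opMul_coeff, Finset.sum_eq_zero]
    intro i hi
    rw [Finset.mem_range] at hi
    rw [(ht i).2 _ (by omega), mul_zero]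
  · rw [h1]; simp [hP, hQ]

/-- The two highest coefficients of the operator `P g`, for an operator `P` of order at most `m + 1`
and a function `g`. -/
lemma opMul_C_coeff (hd : IsDer d) {P : k[X]} {m : ℕ} (hP : P.natDegree ≤ m + 1) (g : k) :
    (opMul d P (C g)).natDegree ≤ m + 1 ∧
    (opMul d P (C g)).coeff (m + 1) = P.coeff (m + 1) * g ∧
    (opMul d P (C g)).coeff m = P.coeff m * g + P.coeff (m + 1) * ((m + 1 : ℕ) * d g) := by
  have ht := coeff_iterate_derivMul_top hd (C g) 0
    (fun j hj => by rw [coeff_C, if_neg (by omega)])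
  simp only [zero_add, coeff_C_zero] at ht
  have hc : ∀ j, (opMul d P (C g)).coeff j =
      ∑ i ∈ Finset.range (m + 2), P.coeff i * ((derivMul d)^[i] (C g)).coeff j := by
    intro j
    rw [opMul_coeff]
    apply Finset.sum_subset (Finset.range_subset_range.2 (by omega))
    intro i _ hi
    rw [Finset.mem_range, not_lt] at hi
    rw [coeff_eq_zero_of_natDegree_lt (by omega), zero_mul]
  refine ⟨?_, ?_, ?_⟩
  · rw [natDegree_le_iff_coeff_eq_zero]
    intro j hj
    rw [hc, Finset.sum_eq_zero]
    intro i hi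
    rw [Finset.mem_range] at hi
    rw [(ht i).2 _ (by omega), mul_zero]
  · rw [hc, Finset.sum_range_succ, Finset.sum_eq_zero, zero_add, (ht _).1]
    intro i hi
    rw [Finset.mem_range] at hi
    rw [(ht i).2 _ (by omega), mul_zero]
  · rw [hc, Finset.sum_range_succ, Finset.sum_range_succ, Finset.sum_eq_zero, zero_add, (ht _).1,
      coeff_iterate_derivMul_C hd]
    intro i hi
    rw [Finset.mem_range] at hi
    rw [(ht i).2 _ (by omega), mul_zero]

end Operators

/-! ### The derivations of `ℚ((z))`, `ℚ(z)` and `ℚ((z))[ln z]` -/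

section Derivations

open Polynomial

lemma laurentDeriv_coeff (f : LaurentSeries ℚ) (m : ℤ) :
    (LaurentSeries.derivative ℚ f).coeff m = (m + 1) * f.coeff (m + 1) := by
  rw [LaurentSeries.derivative_apply, LaurentSeries.hasseDeriv_coeff]
  simp

/-- The coefficient of `z^m` in `(f g)'` is `∑ (i + j) fᵢ gⱼ` over `i + j = m + 1`. -/
lemma laurentDeriv_mul (f g : LaurentSeries ℚ) :
    LaurentSeries.derivative ℚ (f * g) =
      f * LaurentSeries.derivative ℚ g + g * LaurentSeries.derivative ℚ f := by
  -- it suffices to treat the Euler derivation `z d/dz`, which preserves supports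
  have hz : ∀ f : LaurentSeries ℚ, ∀ m, (HahnSeries.single (1 : ℤ) (1 : ℚ) *
      LaurentSeries.derivative ℚ f).coeff m = m * f.coeff m := by
    intro f m
    rw [HahnSeries.coeff_single_mul, laurentDeriv_coeff]
    simp
  have hs : ∀ f : LaurentSeries ℚ, (HahnSeries.single (1 : ℤ) (1 : ℚ) *
      LaurentSeries.derivative ℚ f).support ⊆ f.support := by
    intro f m hm
    rw [HahnSeries.mem_support, hz] at hm
    exact right_ne_zero_of_mul hm
  have h1 : (HahnSeries.single (1 : ℤ) (1 : ℚ) : LaurentSeries ℚ) ≠ 0 := by simp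
  apply mul_left_cancel₀ h1
  have key : HahnSeries.single (1 : ℤ) (1 : ℚ) * LaurentSeries.derivative ℚ (f * g) =
      f * (HahnSeries.single (1 : ℤ) (1 : ℚ) * LaurentSeries.derivative ℚ g) +
      (HahnSeries.single (1 : ℤ) (1 : ℚ) * LaurentSeries.derivative ℚ f) * g := by
    ext m
    rw [hz, HahnSeries.coeff_add, HahnSeries.coeff_mul,
      HahnSeries.coeff_mul_right' g.isPWO_support (hs g),
      HahnSeries.coeff_mul_left' f.isPWO_support (hs f), Finset.mul_sum, ← Finset.sum_add_distrib]
    refine Finset.sum_congr rfl fun ij hij => ?_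
    rw [Finset.mem_antidiagonal] at hij
    rw [hz, hz, ← hij.2.2]
    push_cast
    ring
  rw [key]
  ring

/-- The derivation `d/dz` of `ℚ((z))`. -/
def laurentDer (f : LaurentSeries ℚ) : LaurentSeries ℚ := LaurentSeries.derivative ℚ f

lemma isDer_laurentDer : IsDer laurentDer where
  add f g := map_add (LaurentSeries.derivative ℚ) f g
  mul f g := laurentDeriv_mul f g

lemma laurentDer_coeff (f : LaurentSeries ℚ) (m : ℤ) :
    (laurentDer f).coeff m = (m + 1) * f.coeff (m + 1) := laurentDeriv_coeff f m

lemma laurentDer_C (c : ℚ) : laurentDer (HahnSeries.C c) = 0 := by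
  ext m
  rw [laurentDer_coeff, HahnSeries.C_apply, HahnSeries.coeff_single]
  split_ifs with h
  · have : (m : ℚ) + 1 = 0 := by exact_mod_cast h
    simp [this]
  · simp

/-- A nonzero multiple of `1/z` has no primitive in `ℚ((z))`: this is why logarithms are needed. -/
lemma laurentDer_ne_log (f : LaurentSeries ℚ) {c : ℚ} (hc : c ≠ 0) :
    laurentDer f ≠ HahnSeries.C c * HahnSeries.single (-1) 1 := by
  intro h
  have := congrArg (fun x => HahnSeries.coeff x (-1)) h
  simp only [laurentDer_coeff, HahnSeries.C_mul_eq_smul, HahnSeries.coeff_smul,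
    HahnSeries.coeff_single_same] at this
  simp at this
  exact hc this.symm

lemma ofPowerSeries_derivative (u : PowerSeries ℚ) :
    laurentDer (HahnSeries.ofPowerSeries ℤ ℚ u) =
      HahnSeries.ofPowerSeries ℤ ℚ (PowerSeries.derivative ℚ u) := by
  ext m
  rw [laurentDer_coeff]
  rcases lt_or_ge m 0 with hm | hm
  · rw [PowerSeries.coeff_coe, PowerSeries.coeff_coe, if_pos hm]
    split_ifs with h
    · simp
    · obtain rfl : m = -1 := by omega
      simp
  · lift m to ℕ using hm
    have : ((m : ℤ) + 1) = ((m + 1 : ℕ) : ℤ) := by push_cast; ring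
    rw [this, LaurentSeries.coeff_coe_powerSeries, LaurentSeries.coeff_coe_powerSeries,
      PowerSeries.coeff_derivative]
    push_cast; ring

lemma toLaurent_injective : Function.Injective toLaurent := toLaurent.injective

lemma toLaurent_algebraMap (p : ℚ[X]) :
    toLaurent (algebraMap ℚ[X] (RatFunc ℚ) p) = HahnSeries.ofPowerSeries ℤ ℚ (p : PowerSeries ℚ) :=
  (RatFunc.coe_coe p).symm

lemma laurentDer_toLaurent_algebraMap (p : ℚ[X]) :
    laurentDer (toLaurent (algebraMap ℚ[X] (RatFunc ℚ) p)) =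
      toLaurent (algebraMap ℚ[X] (RatFunc ℚ) (derivative p)) := by
  rw [toLaurent_algebraMap, toLaurent_algebraMap, ofPowerSeries_derivative]
  congr 1
  exact PowerSeries.derivative_coe p

/-- Laurent expansion commutes with `d/dz`. -/
lemma toLaurent_ratDeriv (f : RatFunc ℚ) : toLaurent (ratDeriv f) = laurentDer (toLaurent f) := by
  have hd : algebraMap ℚ[X] (RatFunc ℚ) f.denom ≠ 0 := by
    simpa using RatFunc.denom_ne_zero f
  have hd' : toLaurent (algebraMap ℚ[X] (RatFunc ℚ) f.denom) ≠ 0 := by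
    simpa using hd
  have h1 : toLaurent f * toLaurent (algebraMap ℚ[X] (RatFunc ℚ) f.denom) =
      toLaurent (algebraMap ℚ[X] (RatFunc ℚ) f.num) := by
    rw [← map_mul]
    congr 1
    conv_lhs => rw [← RatFunc.num_div_denom f]
    simp only [RatFunc.num_div_denom]
    exact (eq_div_iff hd).1 (RatFunc.num_div_denom f).symm
  have h2 := congrArg laurentDer h1
  rw [isDer_laurentDer.mul, laurentDer_toLaurent_algebraMap,
    laurentDer_toLaurent_algebraMap] at h2
  rw [ratDeriv, map_div₀, map_pow, map_pow, div_eq_iff (pow_ne_zero 2 hd')]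
  simp only [map_sub, map_mul]
  linear_combination (-(toLaurent (algebraMap ℚ[X] (RatFunc ℚ) f.denom))) * h2 +
    toLaurent (algebraMap ℚ[X] (RatFunc ℚ) (derivative f.denom)) * h1

lemma isDer_ratDeriv : IsDer ratDeriv where
  add f g := toLaurent_injective (by
    simp only [toLaurent_ratDeriv, map_add, isDer_laurentDer.add])
  mul f g := toLaurent_injective (by
    simp only [toLaurent_ratDeriv, map_add, map_mul, isDer_laurentDer.mul])

lemma ratDeriv_X : ratDeriv (algebraMap ℚ[X] (RatFunc ℚ) X) = 1 := by
  apply toLaurent_injective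
  rw [toLaurent_ratDeriv, laurentDer_toLaurent_algebraMap, derivative_X, map_one]

lemma logDeriv_monomial (j : ℕ) (f : LaurentSeries ℚ) :
    logDeriv (monomial j f) = monomial j (laurentDer f) +
      monomial (j - 1) ((j : LaurentSeries ℚ) * HahnSeries.single (-1) 1 * f) := by
  rw [logDeriv, sum_monomial_index]
  · rfl
  · simp

lemma logDeriv_add (x y : LogSeries) : logDeriv (x + y) = logDeriv x + logDeriv y := by
  unfold logDeriv
  rw [sum_add_index]
  · intro j; simp
  · intro j a b; rw [map_add, map_add, mul_add, map_add]; abel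

lemma logDeriv_mul (x y : LogSeries) :
    logDeriv (x * y) = x * logDeriv y + y * logDeriv x := by
  induction x using Polynomial.induction_on' with
  | add p q hp hq => rw [add_mul, logDeriv_add, hp, hq, logDeriv_add]; ring
  | monomial i a =>
    induction y using Polynomial.induction_on' with
    | add p q hp hq => rw [mul_add, logDeriv_add, hp, hq, logDeriv_add]; ring
    | monomial j b =>
      rw [monomial_mul_monomial, logDeriv_monomial, logDeriv_monomial, logDeriv_monomial,
        isDer_laurentDer.mul]
      simp only [mul_add, monomial_mul_monomial, map_add]
      rw [add_comm j i]
      rcases i with _ | i <;> rcases j with _ | j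
      · simp
      · simp; ring_nf
      · simp; ring_nf
      · have e1 : i + 1 + (j + 1) - 1 = i + j + 1 := by omega
        have e2 : i + 1 + (j + 1 - 1) = i + j + 1 := by omega
        have e3 : j + 1 + (i + 1 - 1) = i + j + 1 := by omega
        rw [e1, e2, e3]
        have : (monomial (i + j + 1)) ((((i + 1 + (j + 1) : ℕ) : LaurentSeries ℚ)) *
            HahnSeries.single (-1) 1 * (a * b)) =
          monomial (i + j + 1) (a * (((j + 1 : ℕ) : LaurentSeries ℚ) *
            HahnSeries.single (-1) 1 * b)) +
          monomial (i + j + 1) (b * (((i + 1 : ℕ) : LaurentSeries ℚ) *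
            HahnSeries.single (-1) 1 * a)) := by
          rw [← map_add]
          congr 1
          push_cast
          ring
        rw [this]
        abel

lemma isDer_logDeriv : IsDer logDeriv := ⟨logDeriv_add, logDeriv_mul⟩

lemma logDeriv_C (f : LaurentSeries ℚ) : logDeriv (C f) = C (laurentDer f) := by
  rw [← monomial_zero_left, logDeriv_monomial]
  simp

lemma logDeriv_X : logDeriv X = C (HahnSeries.single (-1) 1) := by
  rw [← monomial_one_one_eq_X, logDeriv_monomial, isDer_laurentDer.one]
  simp

lemma coeff_logDeriv (x : LogSeries) (i : ℕ) :
    (logDeriv x).coeff i = laurentDer (x.coeff i) +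
      ((i + 1 : ℕ) : LaurentSeries ℚ) * HahnSeries.single (-1) 1 * x.coeff (i + 1) := by
  induction x using Polynomial.induction_on' with
  | add p q hp hq => rw [logDeriv_add, coeff_add, hp, hq, coeff_add, coeff_add,
    isDer_laurentDer.add]; ring
  | monomial j a =>
    rw [logDeriv_monomial, coeff_add, coeff_monomial, coeff_monomial, coeff_monomial,
      coeff_monomial]
    rcases j with _ | j
    · simp; split_ifs <;> simp [isDer_laurentDer.zero]
    · simp; split_ifs with h1 h2 <;> simp_all [isDer_laurentDer.zero]

/-- Differentiation with respect to `ln z`, which is the logarithm of the local monodromy up to a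
factor, commutes with `d/dz`. -/
lemma derivative_logDeriv (x : LogSeries) : derivative (logDeriv x) = logDeriv (derivative x) := by
  ext1 i
  simp only [coeff_derivative, coeff_logDeriv, isDer_laurentDer.mul]
  have : laurentDer ((i : LaurentSeries ℚ) + 1) = 0 := by
    have := isDer_laurentDer.natCast (i + 1)
    rwa [Nat.cast_succ] at this
  rw [this]
  push_cast
  ring

end Derivations

/-! ### The recursion for symmetric powers of an operator of order two -/

section SymRec

open Polynomial

variable {k A : Type*} [Field k] [CommRing A]

/-- The operators `L₀ = 1`, `L₁ = ∂`, `Lᵢ₊₁ = (∂ + i p) Lᵢ + i (n - i + 1) q Lᵢ₋₁`. If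
`x'' + p x' + q x = 0`, then `Lᵢ(xⁿ) = n (n - 1) ⋯ (n - i + 1) xⁿ⁻ⁱ (x')ⁱ`, so that `Lₙ₊₁` is the
`n`-th symmetric power of `∂² + p ∂ + q`. -/
def symRec (d : k → k) (p q : k) (n : ℕ) : ℕ → k[X]
  | 0 => 1
  | 1 => X
  | i + 2 => derivMul d (symRec d p q n (i + 1)) +
      C (((i + 1 : ℕ) : k) * p) * symRec d p q n (i + 1)
      + C (((i + 1 : ℕ) : k) * ((n : k) - i) * q) * symRec d p q n i

lemma symRec_succ_succ (d : k → k) (p q : k) (n i : ℕ) :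
    symRec d p q n (i + 2) = derivMul d (symRec d p q n (i + 1)) +
      C (((i + 1 : ℕ) : k) * p) * symRec d p q n (i + 1)
      + C (((i + 1 : ℕ) : k) * ((n : k) - i) * q) * symRec d p q n i := rfl

variable {d : k → k}

lemma symRec_coeff (hd : IsDer d) (p q : k) (n i : ℕ) :
    (symRec d p q n i).coeff i = 1 ∧ ∀ j, i < j → (symRec d p q n i).coeff j = 0 := by
  induction i using Nat.twoStepInduction with
  | zero => exact ⟨by simp [symRec], fun j hj => by
      simp only [symRec]; rw [coeff_one, if_neg (by omega)]⟩
  | one => exact ⟨by simp [symRec], fun j hj => by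
      simp only [symRec]; rw [coeff_X, if_neg (by omega)]⟩
  | more i h0 h1 =>
    simp only [symRec_succ_succ, coeff_add, coeff_C_mul, coeff_derivMul hd]
    constructor
    · rw [coeff_X_mul, h1.1, h1.2 _ (by omega), h0.2 _ (by omega), hd.zero]; simp
    · intro j hj
      obtain ⟨j, rfl⟩ : ∃ j', j = j' + 1 := ⟨j - 1, by omega⟩
      rw [coeff_X_mul, h1.2 _ (by omega), h1.2 _ (by omega), h0.2 _ (by omega), hd.zero]; simp

lemma symRec_natDegree (hd : IsDer d) (p q : k) (n i : ℕ) :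
    (symRec d p q n i).natDegree = i := by
  apply natDegree_eq_of_le_of_coeff_ne_zero
  · rw [natDegree_le_iff_coeff_eq_zero]; exact (symRec_coeff hd p q n i).2
  · rw [(symRec_coeff hd p q n i).1]; exact one_ne_zero

lemma symRec_monic (hd : IsDer d) (p q : k) (n i : ℕ) : (symRec d p q n i).Monic := by
  rw [Monic, leadingCoeff, symRec_natDegree hd, (symRec_coeff hd p q n i).1]

lemma symRec_eval (φ : k →+* A) {D : A → A} (hD : IsDer D) (hd : IsDer d)
    (hφ : ∀ a, D (φ a) = φ (d a)) {p q : k} {x : A}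
    (hx : D (D x) + φ p * D x + φ q * x = 0) (n i : ℕ) (hi : i ≤ n + 1) :
    opEval φ D (symRec d p q n i) (x ^ n) =
      (n.descFactorial i : A) * x ^ (n - i) * D x ^ i := by
  have hX : ∀ y, opEval φ D X y = D y := by
    intro y; rw [← monomial_one_one_eq_X, opEval_monomial]; simp
  induction i using Nat.twoStepInduction with
  | zero =>
    simp only [symRec]
    rw [← C_1, opEval_C]; simp
  | one =>
    simp only [symRec]
    rw [hX]
    rcases n with _ | n
    · simp [hD.one]
    · rw [hD.pow_succ]; simp
  | more i h0 h1 =>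
    obtain ⟨m, rfl⟩ : ∃ m, n = i + 1 + m := ⟨n - (i + 1), by omega⟩
    rw [symRec_succ_succ, opEval_add, opEval_add, opEval_C_mul, opEval_C_mul,
      opEval_derivMul φ hD hd hφ, h0 (by omega), h1 (by omega)]
    have e0 : i + 1 + m - i = m + 1 := by omega
    have e1 : i + 1 + m - (i + 1) = m := by omega
    have e2 : i + 1 + m - (i + 2) = m - 1 := by omega
    rw [Nat.descFactorial_succ _ (i + 1), Nat.descFactorial_succ _ i, e0, e1, e2]
    set N : ℕ := (i + 1 + m).descFactorial i
    have hDD : D (D x) = -(φ p * D x) - φ q * x := by linear_combination hx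
    have hxm : D (x ^ m) = m * x ^ (m - 1) * D x := by
      rcases m with _ | m
      · simp [hD.one]
      · rw [hD.pow_succ, Nat.add_sub_cancel]
    rw [mul_assoc, hD.const_mul (hD.natCast _), hD.mul, hxm, hD.pow_succ, hDD]
    simp only [map_mul, map_sub, map_natCast]
    push_cast
    ring

end SymRec

/-! ### Logarithmic degree and order -/

section LogDegree

open Polynomial

/-- Operators with coefficients in `ℚ((z))`, acting on `ℚ((z))[ln z]`. -/
abbrev lauApply (Q : (LaurentSeries ℚ)[X]) (v : LogSeries) : LogSeries := opEval C logDeriv Q v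

lemma opEval_mul_X {k A : Type*} [Field k] [CommRing A] (φ : k →+* A) (D : A → A) (P : k[X])
    (x : A) : opEval φ D (P * X) x = opEval φ D P (D x) := by
  induction P using Polynomial.induction_on' with
  | add P Q hP hQ => rw [add_mul, opEval_add, opEval_add, hP, hQ]
  | monomial i b =>
    rw [monomial_mul_X, opEval_monomial, opEval_monomial, Function.iterate_succ_apply]

lemma iterate_logDeriv_coeff {v : LogSeries} {m : ℕ} (hv : v.natDegree ≤ m) (i : ℕ) :
    (logDeriv^[i] v).natDegree ≤ m ∧ (logDeriv^[i] v).coeff m = laurentDer^[i] (v.coeff m) := by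
  induction i with
  | zero => exact ⟨hv, rfl⟩
  | succ i ih =>
    simp only [Function.iterate_succ_apply']
    have h := fun j (hj : m < j) => natDegree_le_iff_coeff_eq_zero.1 ih.1 j hj
    constructor
    · rw [natDegree_le_iff_coeff_eq_zero]
      intro j hj
      rw [coeff_logDeriv, h j hj, h (j + 1) (by omega), isDer_laurentDer.zero]; simp
    · rw [coeff_logDeriv, h (m + 1) (by omega), ih.2]; simp

/-- An operator acts on the coefficient of the highest power of `ln z` as on `ℚ((z))`. -/
lemma lauApply_coeff (Q : (LaurentSeries ℚ)[X]) {v : LogSeries} {m : ℕ} (hv : v.natDegree ≤ m) :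
    (lauApply Q v).coeff m = opEval (RingHom.id _) laurentDer Q (v.coeff m) := by
  simp only [opEval, Polynomial.sum_def, finsetSum_coeff, coeff_C_mul,
    (iterate_logDeriv_coeff hv _).2, RingHom.id_apply]

lemma lauApply_C (Q : (LaurentSeries ℚ)[X]) (f : LaurentSeries ℚ) :
    lauApply Q (C f) = C (opEval (RingHom.id _) laurentDer Q f) := by
  have := map_opEval (RingHom.id _) C (D := laurentDer) (E := logDeriv)
    (fun x => (logDeriv_C x).symm) Q f
  rw [this]; rfl

lemma derivative_lauApply (Q : (LaurentSeries ℚ)[X]) (v : LogSeries) :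
    derivative (lauApply Q v) = lauApply Q (derivative v) := by
  have hi : ∀ i, derivative (logDeriv^[i] v) = logDeriv^[i] (derivative v) := by
    intro i
    induction i with
    | zero => rfl
    | succ i ih => rw [Function.iterate_succ_apply', derivative_logDeriv, ih,
        Function.iterate_succ_apply']
  simp only [lauApply, opEval, Polynomial.sum_def, derivative_sum, derivative_C_mul, hi]

/-- A solution of an operator of order `m` has degree less than `m` in `ln z`. The proof is
reduction of order by means of the coefficient of the highest power of `ln z`, which is a solution
in `ℚ((z))`; each step lowers the degree by exactly one, because `1/z` has no primitive in
`ℚ((z))`. -/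
lemma natDegree_lt_of_lauApply_eq_zero {Q : (LaurentSeries ℚ)[X]} (hQ : Q ≠ 0) {v : LogSeries}
    (hv : v ≠ 0) (h : lauApply Q v = 0) : v.natDegree < Q.natDegree := by
  obtain ⟨m, hm⟩ : ∃ m, Q.natDegree = m := ⟨_, rfl⟩
  induction m generalizing Q v with
  | zero =>
    rw [natDegree_eq_zero] at hm
    obtain ⟨c, rfl⟩ := hm
    rw [lauApply, opEval_C] at h
    rcases mul_eq_zero.1 h with h | h
    · exact absurd h hQ
    · exact absurd h hv
  | succ m ih =>
    set f := v.leadingCoeff with hf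
    have hf0 : f ≠ 0 := leadingCoeff_ne_zero.2 hv
    obtain ⟨u, hu⟩ : ∃ u : LogSeries, v = C f * u :=
      ⟨C f⁻¹ * v, by rw [← mul_assoc, ← C_mul, mul_inv_cancel₀ hf0, C_1, one_mul]⟩
    have hu1 : u.natDegree = v.natDegree := by rw [hu, natDegree_C_mul hf0]
    have hu2 : u.coeff v.natDegree = 1 := by
      have : f = f * u.coeff v.natDegree := by
        conv_lhs => rw [hf, leadingCoeff, hu, coeff_C_mul, ← hu]
      exact (mul_right_eq_self₀.1 this.symm).resolve_right hf0
    obtain ⟨hd1, hd2, -⟩ := opMul_C_coeff isDer_laurentDer hm.le f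
    have hQm : Q.coeff (m + 1) ≠ 0 := by rw [← hm]; exact leadingCoeff_ne_zero.2 hQ
    have hev : ∀ x, lauApply (opMul laurentDer Q (C f)) x = lauApply Q (C f * x) := by
      intro x
      rw [lauApply, opEval_opMul C isDer_logDeriv isDer_laurentDer logDeriv_C, opEval_C]
    have hfsol : opEval (RingHom.id _) laurentDer Q f = 0 := by
      rw [hf, leadingCoeff, ← lauApply_coeff Q le_rfl, h, coeff_zero]
    have h0 : (opMul laurentDer Q (C f)).coeff 0 = 0 := by
      have h1 : lauApply (opMul laurentDer Q (C f)) 1 = 0 := by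
        rw [hev, mul_one, lauApply_C, hfsol, C_0]
      have h2 : lauApply (opMul laurentDer Q (C f)) 1 = C ((opMul laurentDer Q (C f)).coeff 0) := by
        rw [lauApply, opEval_eq_sum_range C logDeriv (Nat.lt_succ_self _), Finset.sum_range_succ',
          Finset.sum_eq_zero]
        · simp
        · intro i _
          have : logDeriv^[i] 0 = (0 : LogSeries) := by
            have := isDer_logDeriv.iterate_const_mul i isDer_logDeriv.zero 0
            simpa using this
          rw [Function.iterate_succ_apply, isDer_logDeriv.one, this, mul_zero]
      rw [h1] at h2
      exact (C_eq_zero.1 h2.symm)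
    set Q1 := (opMul laurentDer Q (C f)).divX with hQ1
    have hQ1X : Q1 * X = opMul laurentDer Q (C f) := by
      have := divX_mul_X_add (opMul laurentDer Q (C f))
      rwa [h0, C_0, add_zero] at this
    have hQ1m : Q1.coeff m ≠ 0 := by
      rw [hQ1, coeff_divX, hd2]; exact mul_ne_zero hQm hf0
    have hQ1d : Q1.natDegree = m := by
      apply natDegree_eq_of_le_of_coeff_ne_zero _ hQ1m
      rw [hQ1, natDegree_divX_eq_natDegree_tsub_one]; omega
    have hdu : lauApply Q1 (logDeriv u) = 0 := by
      rw [lauApply, ← opEval_mul_X, hQ1X, ← lauApply, hev, ← hu, h]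
    rcases Nat.eq_zero_or_pos v.natDegree with h0 | hpos
    · omega
    · obtain ⟨j, hj⟩ : ∃ j, v.natDegree = j + 1 := ⟨v.natDegree - 1, by omega⟩
      have hne : (logDeriv u).coeff j ≠ 0 := by
        rw [coeff_logDeriv, ← hj, hu2, mul_one]
        intro h
        apply laurentDer_ne_log (-u.coeff j) (c := (v.natDegree : ℚ)) (by
          rw [hj]; exact_mod_cast Nat.succ_ne_zero j)
        rw [isDer_laurentDer.neg, map_natCast]
        linear_combination -h
      have := ih (Q := Q1) (v := logDeriv u) (fun h => hQ1m (by rw [h, coeff_zero]))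
        (fun h => hne (by rw [h, coeff_zero])) hdu hQ1d
      have := le_natDegree_of_ne_zero hne
      omega

/-- The action of `ℚ(z)[∂]` on `ℚ((z))[ln z]` factors through `ℚ((z))[∂]`. -/
lemma logApply_eq (P : DiffOp) (v : LogSeries) : logApply P v = lauApply (P.map toLaurent) v :=
  (opEval_map C toLaurent P v).symm

lemma natDegree_lt_of_logApply_eq_zero {P : DiffOp} (hP : P ≠ 0) {v : LogSeries}
    (hv : v ≠ 0) (h : logApply P v = 0) : v.natDegree < P.natDegree := by
  rw [logApply_eq] at h
  have := natDegree_lt_of_lauApply_eq_zero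
    ((Polynomial.map_ne_zero_iff toLaurent_injective).2 hP) hv h
  rwa [natDegree_map] at this

lemma logDeriv_toLaurent (a : RatFunc ℚ) :
    logDeriv ((C.comp toLaurent) a) = (C.comp toLaurent) (ratDeriv a) := by
  rw [RingHom.comp_apply, logDeriv_C, RingHom.comp_apply, toLaurent_ratDeriv]

lemma logApply_comp (P Q : DiffOp) (v : LogSeries) :
    logApply (DiffOp.comp P Q) v = logApply P (logApply Q v) :=
  opEval_opMul (C.comp toLaurent) isDer_logDeriv isDer_ratDeriv logDeriv_toLaurent P Q v

end LogDegree

/-! ### The symmetric power as an explicit operator -/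

section SymPower

open Polynomial

lemma symDeriv_isDer (L : DiffOp) : IsDer L.symDeriv := by
  set E : L.SymAlg → L.SymAlg := fun p =>
    ∑ m ∈ p.support, MvPolynomial.monomial m (ratDeriv (p.coeff m)) with hE
  have hc : ∀ p m, (E p).coeff m = ratDeriv (p.coeff m) := by
    intro p m
    rw [hE]
    simp only [MvPolynomial.coeff_sum, MvPolynomial.coeff_monomial, Finset.sum_ite_eq']
    split_ifs with h
    · rfl
    · rw [MvPolynomial.notMem_support_iff.1 h, isDer_ratDeriv.zero]
  have hEd : IsDer E := by
    constructor
    · intro x y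
      ext m
      simp only [hc, MvPolynomial.coeff_add, isDer_ratDeriv.add]
    · intro x y
      ext m
      rw [hc, MvPolynomial.coeff_add, mul_comm y, MvPolynomial.coeff_mul, MvPolynomial.coeff_mul,
        MvPolynomial.coeff_mul, isDer_ratDeriv.sum, ← Finset.sum_add_distrib]
      refine Finset.sum_congr rfl fun ij _ => ?_
      rw [hc, hc, isDer_ratDeriv.mul]; ring
  constructor
  · intro x y
    have := hEd.add x y
    simp only [hE] at this
    simp only [DiffOp.symDeriv, this, map_add]
    ring
  · intro x y
    have := hEd.mul x y
    simp only [hE] at this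
    simp only [DiffOp.symDeriv, this, Derivation.leibniz, smul_eq_mul]
    ring

lemma symDeriv_C (L : DiffOp) (a : RatFunc ℚ) :
    L.symDeriv (MvPolynomial.C a) = MvPolynomial.C (ratDeriv a) := by
  unfold DiffOp.symDeriv
  rw [MvPolynomial.derivation_C, add_zero]
  ext m
  simp only [MvPolynomial.coeff_sum, MvPolynomial.coeff_monomial, Finset.sum_ite_eq',
    MvPolynomial.coeff_C]
  split_ifs with h1 h2 h2
  · rfl
  · exact isDer_ratDeriv.zero
  · rw [MvPolynomial.notMem_support_iff, MvPolynomial.coeff_C, if_pos h2] at h1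
    rw [h1, isDer_ratDeriv.zero]
  · rfl

lemma symDeriv_X (L : DiffOp) (i : Fin L.natDegree) :
    L.symDeriv (MvPolynomial.X i) =
      if h : (i : ℕ) + 1 < L.natDegree then (MvPolynomial.X ⟨i + 1, h⟩ : L.SymAlg)
        else -∑ j : Fin L.natDegree,
          MvPolynomial.C (L.coeff j / L.leadingCoeff) * MvPolynomial.X j := by
  unfold DiffOp.symDeriv
  rw [MvPolynomial.mkDerivation_X, add_eq_right, MvPolynomial.support_X, Finset.sum_singleton,
    MvPolynomial.coeff_X, if_pos rfl, isDer_ratDeriv.one, MvPolynomial.monomial_zero]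

/-- The coefficient of `∂` in the monic operator obtained from `L`. -/
def monicP (L : DiffOp) : RatFunc ℚ := L.coeff 1 / L.leadingCoeff

/-- The coefficient of `∂⁰` in the monic operator obtained from `L`. -/
def monicQ (L : DiffOp) : RatFunc ℚ := L.coeff 0 / L.leadingCoeff

/-- The embedding of `ℚ(z)` into `ℚ((z))[ln z]`. -/
abbrev toLog : RatFunc ℚ →+* LogSeries := C.comp toLaurent

lemma opEval_order_two {A : Type*} [CommRing A] (φ : RatFunc ℚ →+* A) (D : A → A) {L : DiffOp}
    (h2 : L.natDegree = 2) (x : A) : opEval φ D L x =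
      φ L.leadingCoeff * (D (D x) + φ (monicP L) * D x + φ (monicQ L) * x) := by
  have hl : L.leadingCoeff ≠ 0 := leadingCoeff_ne_zero.2 (fun h => by rw [h] at h2; simp at h2)
  have h1 : φ (L.coeff 1) = φ L.leadingCoeff * φ (monicP L) := by
    rw [← map_mul, monicP, mul_div_cancel₀ _ hl]
  have h0 : φ (L.coeff 0) = φ L.leadingCoeff * φ (monicQ L) := by
    rw [← map_mul, monicQ, mul_div_cancel₀ _ hl]
  have hl2 : L.coeff 2 = L.leadingCoeff := by rw [leadingCoeff, h2]
  rw [opEval_eq_sum_range φ D (m := 3) (by omega)]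
  simp only [Finset.sum_range_succ, Finset.sum_range_zero, h0, h1, hl2]
  simp only [Function.iterate_succ_apply, Function.iterate_zero_apply]
  ring

lemma logApply_eq_zero_iff {L : DiffOp} (h2 : L.natDegree = 2) (v : LogSeries) :
    logApply L v = 0 ↔
      logDeriv (logDeriv v) + toLog (monicP L) * logDeriv v + toLog (monicQ L) * v = 0 := by
  have hl : L.leadingCoeff ≠ 0 := leadingCoeff_ne_zero.2 (fun h => by rw [h] at h2; simp at h2)
  have := opEval_order_two toLog logDeriv h2 v
  rw [show logApply L v = opEval toLog logDeriv L v from rfl, this, mul_eq_zero, or_iff_right]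
  exact (map_ne_zero_iff toLog (C_injective.comp toLaurent_injective)).2 hl

/-- The explicit form of `Symⁿ(L)` for an operator `L` of order two, see `symPower_eq`. -/
def symOp (L : DiffOp) (n : ℕ) : DiffOp := symRec ratDeriv (monicP L) (monicQ L) n (n + 1)

lemma symOp_natDegree (L : DiffOp) (n : ℕ) : (symOp L n).natDegree = n + 1 :=
  symRec_natDegree isDer_ratDeriv _ _ _ _

lemma symOp_monic (L : DiffOp) (n : ℕ) : (symOp L n).Monic :=
  symRec_monic isDer_ratDeriv _ _ _ _

/-- `Symⁿ(L)` kills the `n`-th power of each solution of `L`. -/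
lemma logApply_symRec_pow {L : DiffOp} (h2 : L.natDegree = 2) {v : LogSeries}
    (hv : logApply L v = 0) (n : ℕ) : logApply (symOp L n) (v ^ n) = 0 := by
  have := symRec_eval toLog isDer_logDeriv isDer_ratDeriv logDeriv_toLaurent
    ((logApply_eq_zero_iff h2 v).1 hv) n (n + 1) le_rfl
  rw [Nat.descFactorial_of_lt (Nat.lt_succ_self n)] at this
  exact this.trans (by simp)

/-- Given a solution of `L` that involves `ln z`, the explicit operator is the symmetric power.
Minimality of the order follows by mapping the symmetric algebra of `M_L` to `ℚ((z))[ln z]`, with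
`e` going to that solution: the `n`-th power of the solution has degree `n` in `ln z`. -/
lemma symPower_eq {L : DiffOp} (h2 : L.natDegree = 2) {v : LogSeries} (hv : logApply L v = 0)
    (hdeg : v.natDegree = 1) (n : ℕ) : DiffOp.symPower n L = symOp L n := by
  have h0lt : 0 < L.natDegree := by omega
  have h1lt : 1 < L.natDegree := by omega
  have hD := symDeriv_isDer L
  have hmark : L.marked = MvPolynomial.X ⟨0, h0lt⟩ := by rw [DiffOp.marked, dif_pos h0lt]
  have hX0 : L.symDeriv (MvPolynomial.X ⟨0, h0lt⟩) = MvPolynomial.X ⟨1, h1lt⟩ := by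
    rw [symDeriv_X, dif_pos h1lt]
  have hX1 : L.symDeriv (MvPolynomial.X ⟨1, h1lt⟩) =
      -(MvPolynomial.C (monicQ L) * MvPolynomial.X ⟨0, h0lt⟩ +
        MvPolynomial.C (monicP L) * MvPolynomial.X ⟨1, h1lt⟩) := by
    rw [symDeriv_X, dif_neg (by simp only; omega)]
    congr 1
    have e : ∀ f : Fin L.natDegree → L.SymAlg,
        ∑ j, f j = f ⟨0, h0lt⟩ + f ⟨1, h1lt⟩ := by
      intro f
      rw [← (finCongr h2.symm).sum_comp f, Fin.sum_univ_two]
      rfl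
    rw [e]
    rfl
  -- the operator kills `eⁿ`
  have hkill : DiffOp.apply MvPolynomial.C L.symDeriv (symOp L n) (L.marked ^ n) = 0 := by
    have := symRec_eval (MvPolynomial.C : RatFunc ℚ →+* L.SymAlg) hD isDer_ratDeriv (symDeriv_C L)
      (p := monicP L) (q := monicQ L) (x := MvPolynomial.X ⟨0, h0lt⟩)
      (by rw [hX0, hX1]; ring) n (n + 1) le_rfl
    rw [Nat.descFactorial_of_lt (Nat.lt_succ_self n)] at this
    rw [hmark]
    exact this.trans (by simp)
  -- evaluation at the logarithmic solution
  have hv' := (logApply_eq_zero_iff h2 v).1 hv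
  set ev : L.SymAlg →+* LogSeries :=
    MvPolynomial.eval₂Hom toLog (fun i => logDeriv^[(i : ℕ)] v) with hev
  have hevX : ∀ i, ev (MvPolynomial.X i) = logDeriv^[(i : ℕ)] v := fun i => by simp [hev]
  have hevC : ∀ a, ev (MvPolynomial.C a) = toLog a := fun a => by
    rw [hev, MvPolynomial.eval₂Hom_C]
  have hcomm : ∀ x, ev (L.symDeriv x) = logDeriv (ev x) := by
    intro x
    induction x using MvPolynomial.induction_on with
    | C a => rw [symDeriv_C, hevC, hevC, logDeriv_toLaurent]
    | add x y hx hy => rw [hD.add, map_add, map_add, isDer_logDeriv.add, hx, hy]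
    | mul_X x i hx =>
      have hi : ev (L.symDeriv (MvPolynomial.X i)) = logDeriv (ev (MvPolynomial.X i)) := by
        obtain ⟨i, hi⟩ := i
        obtain rfl | rfl : i = 0 ∨ i = 1 := by omega
        · rw [hX0, hevX, hevX]; rfl
        · rw [hX1, map_neg, map_add, map_mul, map_mul, hevC, hevC, hevX, hevX]
          change -(toLog (monicQ L) * v + toLog (monicP L) * logDeriv v) = logDeriv (logDeriv v)
          linear_combination -hv'
      rw [hD.mul, map_add, map_mul, map_mul, map_mul, isDer_logDeriv.mul, hx, hi]
  have hmin : ∀ Q : DiffOp, Q ≠ 0 →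
      DiffOp.apply MvPolynomial.C L.symDeriv Q (L.marked ^ n) = 0 → n + 1 ≤ Q.natDegree := by
    intro Q hQ h
    have h1 := map_opEval (MvPolynomial.C : RatFunc ℚ →+* L.SymAlg) ev hcomm Q (L.marked ^ n)
    rw [show opEval MvPolynomial.C L.symDeriv Q (L.marked ^ n) = 0 from h, map_zero, map_pow, hmark,
      hevX] at h1
    have hcomp : ev.comp MvPolynomial.C = toLog := RingHom.ext hevC
    rw [hcomp] at h1
    have hv0 : v ≠ 0 := fun h => by rw [h] at hdeg; simp at hdeg
    have := natDegree_lt_of_logApply_eq_zero hQ (pow_ne_zero n hv0) h1.symm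
    rwa [natDegree_pow, hdeg, mul_one] at this
  have hmo : L.IsMinimalOperator (L.marked ^ n) (symOp L n) :=
    ⟨symOp_monic L n, hkill, fun Q hQ h => by rw [symOp_natDegree]; exact hmin Q hQ h⟩
  have hex : ∃ P, L.IsMinimalOperator (L.marked ^ n) P := ⟨_, hmo⟩
  have hch := hex.choose_spec
  rw [DiffOp.symPower, dif_pos hex]
  set P := hex.choose
  -- two minimal operators agree, as their difference has smaller order
  by_contra hne
  have hPd : P.natDegree = n + 1 := le_antisymm
    (by simpa [symOp_natDegree] using hch.2.2 _ (symOp_monic L n).ne_zero hkill)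
    (hmin P hch.1.ne_zero hch.2.1)
  have hsub : P - symOp L n ≠ 0 := sub_ne_zero.2 hne
  have h1 := hmin _ hsub (by
    have := opEval_sub MvPolynomial.C L.symDeriv P (symOp L n) (L.marked ^ n)
    rw [show opEval MvPolynomial.C L.symDeriv P (L.marked ^ n) = 0 from hch.2.1,
      show opEval MvPolynomial.C L.symDeriv (symOp L n) (L.marked ^ n) = 0 from hkill, sub_zero]
      at this
    exact this)
  have h2 : (P - symOp L n).degree < P.degree := degree_sub_lt_left (by
    rw [degree_eq_natDegree hch.1.ne_zero, degree_eq_natDegree (symOp_monic L n).ne_zero, hPd,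
      symOp_natDegree]) hch.1.ne_zero (by
    rw [hch.1.leadingCoeff, (symOp_monic L n).leadingCoeff])
  have := natDegree_lt_natDegree hsub h2
  omega

end SymPower

/-! ### Lowest coefficients and exponents -/

section Lowest

open Polynomial

/-- `f` has no coefficients below `z^s`, and its coefficient at `z^s` is `c`, which may be `0`. -/
def HasLowest (f : LaurentSeries ℚ) (s : ℤ) (c : ℚ) : Prop :=
  (∀ m < s, f.coeff m = 0) ∧ f.coeff s = c

lemma HasLowest.add {f g : LaurentSeries ℚ} {s : ℤ} {a b : ℚ} (hf : HasLowest f s a)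
    (hg : HasLowest g s b) : HasLowest (f + g) s (a + b) :=
  ⟨fun m hm => by rw [HahnSeries.coeff_add, hf.1 m hm, hg.1 m hm, add_zero], by
    rw [HahnSeries.coeff_add, hf.2, hg.2]⟩

lemma HasLowest.sum {ι : Type*} (t : Finset ι) {f : ι → LaurentSeries ℚ} {s : ℤ} {a : ι → ℚ}
    (hf : ∀ i ∈ t, HasLowest (f i) s (a i)) : HasLowest (∑ i ∈ t, f i) s (∑ i ∈ t, a i) := by
  induction t using Finset.cons_induction with
  | empty => exact ⟨fun m _ => by simp, by simp⟩
  | cons i t hi ih =>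
    rw [Finset.sum_cons, Finset.sum_cons]
    exact (hf i (Finset.mem_cons_self i t)).add
      (ih fun j hj => hf j (Finset.mem_cons.2 (Or.inr hj)))

lemma HasLowest.mul {f g : LaurentSeries ℚ} {s t : ℤ} {a b : ℚ} (hf : HasLowest f s a)
    (hg : HasLowest g t b) : HasLowest (f * g) (s + t) (a * b) := by
  have hs : ∀ i, f.coeff i ≠ 0 → s ≤ i := fun i hi => by
    by_contra h; exact hi (hf.1 i (not_le.1 h))
  have ht : ∀ i, g.coeff i ≠ 0 → t ≤ i := fun i hi => by
    by_contra h; exact hi (hg.1 i (not_le.1 h))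
  constructor
  · intro m hm
    rw [HahnSeries.coeff_mul, Finset.sum_eq_zero]
    intro ij hij
    rw [Finset.mem_antidiagonal] at hij
    have h1 := hs _ hij.1
    have h2 := ht _ hij.2.1
    have h3 := hij.2.2
    omega
  · rw [HahnSeries.coeff_mul, ← hf.2, ← hg.2]
    rw [Finset.sum_eq_single (s, t)]
    · intro ij hij hne
      rw [Finset.mem_antidiagonal] at hij
      have h1 := hs _ hij.1
      have h2 := ht _ hij.2.1
      have h3 := hij.2.2
      exact absurd (Prod.ext (by simp only; omega) (by simp only; omega)) hne
    · intro hn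
      by_contra h
      apply hn
      rw [Finset.mem_antidiagonal]
      exact ⟨left_ne_zero_of_mul h, right_ne_zero_of_mul h, rfl⟩

lemma HasLowest.laurentDer {f : LaurentSeries ℚ} {s : ℤ} {a : ℚ} (hf : HasLowest f s a) :
    HasLowest (laurentDer f) (s - 1) (s * a) :=
  ⟨fun m hm => by rw [laurentDer_coeff, hf.1 _ (by omega), mul_zero], by
    rw [laurentDer_coeff, sub_add_cancel, hf.2]; push_cast; ring⟩

lemma HasLowest.iterate_laurentDer {f : LaurentSeries ℚ} {s : ℤ} {a : ℚ} (hf : HasLowest f s a)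
    (i : ℕ) : HasLowest (CalabiYauOp.laurentDer^[i] f) (s - i)
      ((descPochhammer ℚ i).eval (s : ℚ) * a) := by
  induction i with
  | zero => simpa using hf
  | succ i ih =>
    rw [Function.iterate_succ_apply', descPochhammer_succ_eval]
    have := ih.laurentDer
    convert this using 1
    · push_cast; ring
    · push_cast; ring

/-- The indicial polynomial gives the lowest coefficient of the value of an operator. -/
lemma indicial_eval_mul_eq_zero {P : DiffOp} (hP : P ≠ 0) (hreg : P.IsRegularSingularAtZero)
    {f : LaurentSeries ℚ} {s : ℤ} {a : ℚ} (hf : HasLowest f s a)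
    (h : opEval toLaurent laurentDer P f = 0) : P.indicial.eval (s : ℚ) * a = 0 := by
  have hl : toLaurent P.leadingCoeff ≠ 0 := by simpa using hP
  have h1 : ∑ i ∈ Finset.range (P.natDegree + 1), P.monicCoeff i * laurentDer^[i] f = 0 := by
    apply mul_left_cancel₀ hl
    rw [mul_zero, ← h, opEval_eq_sum_range _ _ (Nat.lt_succ_self _), Finset.mul_sum]
    refine Finset.sum_congr rfl fun i _ => ?_
    rw [DiffOp.monicCoeff, map_div₀, ← mul_assoc, mul_div_cancel₀ _ hl]
  have h2 : HasLowest (∑ i ∈ Finset.range (P.natDegree + 1), P.monicCoeff i * laurentDer^[i] f)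
      (s - P.natDegree) (∑ i ∈ Finset.range (P.natDegree + 1),
        (P.monicCoeff i).coeff ((i : ℤ) - P.natDegree) *
          ((descPochhammer ℚ i).eval (s : ℚ) * a)) := by
    apply HasLowest.sum
    intro i hi
    rw [Finset.mem_range] at hi
    have hm : HasLowest (P.monicCoeff i) ((i : ℤ) - P.natDegree)
      ((P.monicCoeff i).coeff ((i : ℤ) - P.natDegree)) := ⟨hreg i (by omega), rfl⟩
    have := hm.mul (hf.iterate_laurentDer i)
    convert this using 1
    ring
  have h3 := h2.2
  rw [h1, HahnSeries.coeff_zero] at h3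
  rw [h3, DiffOp.indicial, eval_finsetSum, Finset.sum_mul]
  refine Finset.sum_congr rfl fun i _ => ?_
  rw [eval_mul, eval_C]; ring

/-- If all exponents of `P` are equal to `r`, a solution in `ℚ((z))` is determined by its
coefficient at `z^r`. -/
lemma exists_coeff_determines {P : DiffOp} (hP : P.HasEqualIntegralExponents) (hP0 : P ≠ 0) :
    ∃ r : ℤ, ∀ f : LaurentSeries ℚ, logApply P (C f) = 0 → f.coeff r = 0 → f = 0 := by
  obtain ⟨hreg, r, hr⟩ := hP
  refine ⟨r, fun f hf h0 => ?_⟩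
  by_contra hne
  have h1 : opEval toLaurent laurentDer P f = 0 := by
    rw [logApply_eq, lauApply_C, C_eq_zero, opEval_map] at hf
    exact hf
  have hlow : HasLowest f f.order (f.coeff f.order) :=
    ⟨fun m hm => HahnSeries.coeff_eq_zero_of_lt_order hm, rfl⟩
  have h2 := indicial_eval_mul_eq_zero hP0 hreg hlow h1
  have hc : f.coeff f.order ≠ 0 := HahnSeries.coeff_order_eq_zero.not.2 hne
  rw [mul_eq_zero, or_iff_left hc, hr, eval_pow, eval_sub, eval_X, eval_C] at h2
  have h3 := sub_eq_zero.1 (pow_eq_zero_iff (fun h => by simp [h] at h2) |>.1 h2)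
  have h4 : f.order = r := by exact_mod_cast h3
  rw [h4] at hc
  exact hc h0

end Lowest

/-! ### Flags and structure series -/

section Frames

open Polynomial

/-- The constants `ℚ` in `ℚ((z))[ln z]`. -/
abbrev ratLog : ℚ →+* LogSeries := C.comp HahnSeries.C

lemma logDeriv_ratLog (c : ℚ) : logDeriv (ratLog c) = 0 := by
  rw [RingHom.comp_apply, logDeriv_C, laurentDer_C, C_0]

lemma iterate_derivative_logApply (P : DiffOp) (k : ℕ) (v : LogSeries) :
    derivative^[k] (logApply P v) = logApply P (derivative^[k] v) := by
  induction k generalizing v with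
  | zero => rfl
  | succ k ih =>
    rw [Function.iterate_succ_apply, Function.iterate_succ_apply, logApply_eq,
      derivative_lauApply, ← logApply_eq, ih]

/-- Up to a nonzero factor, `f (ln z + g)ⁿ⁻ᵃ` is the `a`-th derivative of `f (ln z + g)ⁿ` with
respect to `ln z`. -/
lemma logApply_pow_eq_zero (P : DiffOp) (f g : LaurentSeries ℚ) {a n : ℕ} (ha : a ≤ n)
    (h : derivative^[a] (logApply P (C f * (X + C g) ^ n)) = 0) :
    logApply P (C f * (X + C g) ^ (n - a)) = 0 := by
  rw [iterate_derivative_logApply, iterate_derivative_C_mul, iterate_derivative_X_add_pow,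
    nsmul_eq_mul, mul_left_comm] at h
  have h1 := opEval_const_mul toLog isDer_logDeriv P
    (isDer_logDeriv.natCast (n.descFactorial a)) (C f * (X + C g) ^ (n - a))
  refine (mul_eq_zero.1 (h1.symm.trans h)).resolve_left ?_
  rw [← map_natCast ratLog, ← ne_eq, map_ne_zero_iff ratLog ratLog.injective]
  exact_mod_cast (Nat.descFactorial_pos.2 ha).ne'

lemma logDeriv_eval₂ (τ : LogSeries) (s : ℚ[X]) :
    logDeriv (eval₂ ratLog τ s) = eval₂ ratLog τ (derivative s) * logDeriv τ := by
  induction s using Polynomial.induction_on' with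
  | add p q hp hq =>
    rw [eval₂_add, isDer_logDeriv.add, hp, hq, derivative_add, eval₂_add]; ring
  | monomial i c =>
    rw [eval₂_monomial, derivative_monomial, eval₂_monomial,
      isDer_logDeriv.const_mul (logDeriv_ratLog c)]
    rcases i with _ | i
    · simp [isDer_logDeriv.one]
    · rw [isDer_logDeriv.pow_succ, map_mul, map_natCast, Nat.add_sub_cancel]; ring

lemma logTheta_eval₂ (τ : LogSeries) (s : ℚ[X]) :
    logTheta (eval₂ ratLog τ s) = eval₂ ratLog τ (derivative s) * logTheta τ := by
  rw [logTheta, logDeriv_eval₂, logTheta]; ring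

lemma ringInverse_C {u : LaurentSeries ℚ} (hu : u ≠ 0) :
    Ring.inverse (C u : LogSeries) = C u⁻¹ := by
  have h : (C u : LogSeries) * C u⁻¹ = 1 := by rw [← C_mul, mul_inv_cancel₀ hu, C_1]
  have h' : (C u⁻¹ : LogSeries) * C u = 1 := by rw [mul_comm, h]
  exact Ring.inverse_unit ⟨C u, C u⁻¹, h, h'⟩

lemma flagSol_natDegree_le (f : ℕ → LaurentSeries ℚ) (k : ℕ) : (flagSol f k).natDegree ≤ k := by
  apply natDegree_sum_le_of_forall_le
  intro i hi
  rw [Finset.mem_range] at hi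
  exact (natDegree_monomial_le _).trans (by omega)

lemma flagSol_coeff_self (f : ℕ → LaurentSeries ℚ) (k : ℕ) :
    (flagSol f k).coeff k = HahnSeries.C ((k.factorial : ℚ)⁻¹) * f 0 := by
  rw [flagSol, finsetSum_coeff, Finset.sum_eq_single k]
  · rw [coeff_monomial, if_pos rfl, Nat.sub_self, HahnSeries.C_mul_eq_smul]
  · intro i _ hi
    rw [coeff_monomial, if_neg hi]
  · intro h
    simp at h

/-- A flag of `P` in explicit form: with `τ = ln z + g`, the functions `f₀ τᵏ / k!` for `k` less
than the order of `P` are a flag, all exponents of `P` are equal, and `α` is the inverse of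
`z dτ/dz`. CY-type operators of order two have a frame, and so do their symmetric powers. -/
structure IsFrame (P : DiffOp) (α : PowerSeries ℚ) (f₀ g : LaurentSeries ℚ) : Prop where
  exponents : P.HasEqualIntegralExponents
  normalized : ∃ (r : ℤ) (u : PowerSeries ℚ), PowerSeries.constantCoeff u = 1 ∧
      f₀ = HahnSeries.single r 1 * HahnSeries.ofPowerSeries ℤ ℚ u
  sol : ∀ k < P.natDegree, logApply P (C f₀ * (X + C g) ^ k) = 0
  theta : C (HahnSeries.ofPowerSeries ℤ ℚ α) * logTheta (X + C g) = 1

lemma ne_zero_of_normalized {f₀ : LaurentSeries ℚ} (h : ∃ (r : ℤ) (u : PowerSeries ℚ),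
    PowerSeries.constantCoeff u = 1 ∧
      f₀ = HahnSeries.single r 1 * HahnSeries.ofPowerSeries ℤ ℚ u) : f₀ ≠ 0 := by
  obtain ⟨r, u, hu, rfl⟩ := h
  apply mul_ne_zero
  · simp
  · rw [map_ne_zero_iff _ HahnSeries.ofPowerSeries_injective]
    rintro rfl
    simp at hu

lemma logTheta_X_add_C (g : LaurentSeries ℚ) :
    logTheta (X + C g) = C (1 + HahnSeries.single 1 1 * laurentDer g) := by
  rw [logTheta, isDer_logDeriv.add, logDeriv_X, logDeriv_C, ← C_add, ← C_mul, mul_add,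
    HahnSeries.single_mul_single]
  simp

variable {P : DiffOp} {α : PowerSeries ℚ} {f₀ g : LaurentSeries ℚ}

lemma IsFrame.exists_theta_eq (hF : IsFrame P α f₀ g) :
    ∃ h : LaurentSeries ℚ, h ≠ 0 ∧ HahnSeries.ofPowerSeries ℤ ℚ α * h = 1 ∧
      logTheta (X + C g) = C h := by
  have h1 := hF.theta
  rw [logTheta_X_add_C, ← C_mul, ← C_1] at h1
  have h2 := C_injective h1
  exact ⟨_, right_ne_zero_of_mul_eq_one h2, h2, logTheta_X_add_C g⟩

/-- The solutions of degree less than `k` in `ln z` are spanned by the `f₀ τʲ` with `j < k`. -/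
lemma IsFrame.exists_eval₂ (hF : IsFrame P α f₀ g) (hP : P ≠ 0) (k : ℕ) (hk : k ≤ P.natDegree)
    (v : LogSeries) (hv : v.degree < k) (hsol : logApply P v = 0) :
    ∃ s : ℚ[X], s.degree < k ∧ v = C f₀ * eval₂ ratLog (X + C g) s := by
  obtain ⟨r, hr⟩ := exists_coeff_determines hF.exponents hP
  have hf0 := ne_zero_of_normalized hF.normalized
  induction k generalizing v with
  | zero =>
    refine ⟨0, by simp, ?_⟩
    have : v = 0 := by simpa using hv
    simp [this]
  | succ k ih =>
    have hnd : v.natDegree ≤ k := natDegree_le_iff_coeff_eq_zero.2 fun j hj =>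
      (degree_lt_iff_coeff_zero _ _).1 hv j hj
    have hf0sol : logApply P (C f₀) = 0 := by simpa using hF.sol 0 (by omega)
    have hf0r : f₀.coeff r ≠ 0 := fun h => hf0 (hr _ hf0sol h)
    -- the coefficient of the highest power of `ln z` is a constant multiple of `f₀`
    have ha : logApply P (C (v.coeff k)) = 0 := by
      rw [logApply_eq, lauApply_C, ← lauApply_coeff _ hnd, ← logApply_eq, hsol, coeff_zero, C_0]
    set c : ℚ := (v.coeff k).coeff r / f₀.coeff r with hc
    have hvc : v.coeff k = HahnSeries.C c * f₀ := by
      rw [← sub_eq_zero]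
      apply hr
      · have h1 := opEval_apply_sub toLog isDer_logDeriv P (C (v.coeff k)) (ratLog c * C f₀)
        rw [opEval_const_mul toLog isDer_logDeriv P (logDeriv_ratLog c)] at h1
        rw [show opEval toLog logDeriv P (C (v.coeff k)) = 0 from ha,
          show opEval toLog logDeriv P (C f₀) = 0 from hf0sol, mul_zero, sub_zero] at h1
        rw [C_sub, C_mul]
        exact h1
      · rw [HahnSeries.coeff_sub, HahnSeries.C_mul_eq_smul, HahnSeries.coeff_smul, hc, smul_eq_mul,
          div_mul_cancel₀ _ hf0r, sub_self]
    set w : LogSeries := ratLog c * (C f₀ * (X + C g) ^ k) with hw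
    have hwsol : logApply P w = 0 := by
      have h1 := opEval_const_mul toLog isDer_logDeriv P (logDeriv_ratLog c)
        (C f₀ * (X + C g) ^ k)
      rw [show opEval toLog logDeriv P (C f₀ * (X + C g) ^ k) = 0 from hF.sol k (by omega),
        mul_zero] at h1
      exact h1
    have hwd : w.natDegree ≤ k := by
      rw [hw, RingHom.comp_apply]
      refine (natDegree_C_mul_le _ _).trans ((natDegree_C_mul_le _ _).trans ?_)
      rw [natDegree_pow, natDegree_X_add_C, mul_one]
    have hwk : w.coeff k = HahnSeries.C c * f₀ := by
      have h1 : ((X + C g : LogSeries) ^ k).coeff k = 1 := by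
        have := ((monic_X_add_C g).pow k).coeff_natDegree
        rwa [natDegree_pow, natDegree_X_add_C, mul_one] at this
      rw [hw, RingHom.comp_apply, coeff_C_mul, coeff_C_mul, h1, mul_one]
    obtain ⟨s, hs, hvs⟩ := ih (by omega) (v - w) (by
      rw [degree_lt_iff_coeff_zero]
      intro m hm
      rcases hm.eq_or_lt with rfl | hm
      · rw [coeff_sub, hvc, hwk, sub_self]
      · rw [coeff_sub, coeff_eq_zero_of_natDegree_lt (by omega),
          coeff_eq_zero_of_natDegree_lt (by omega), sub_self]) (by
      have h1 := opEval_apply_sub toLog isDer_logDeriv P v w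
      rw [show opEval toLog logDeriv P v = 0 from hsol,
        show opEval toLog logDeriv P w = 0 from hwsol, sub_zero] at h1
      exact h1)
    refine ⟨s + monomial k c, ?_, ?_⟩
    · refine (degree_add_le _ _).trans_lt (max_lt (hs.trans ?_) ?_)
      · exact_mod_cast Nat.lt_succ_self k
      · exact (degree_monomial_le k c).trans_lt (by exact_mod_cast Nat.lt_succ_self k)
    · rw [eval₂_add, eval₂_monomial, mul_add, ← hvs, hw]; ring

/-- Every flag is related to the frame by a unipotent triangular matrix over `ℚ`, up to a common
factor, so that the operators `𝒩ᵢ` of the flag are those of the frame up to that factor. -/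
lemma IsFrame.normalOp_flagSol (hF : IsFrame P α f₀ g) (hP : P ≠ 0) {f : ℕ → LaurentSeries ℚ}
    (hf : IsFlag P f) {i : ℕ} (hi : i + 1 < P.natDegree) :
    normalOp (flagSol f) (i + 1) (flagSol f (i + 1)) = logTheta (X + C g) := by
  obtain ⟨h, hh0, -, hh⟩ := hF.exists_theta_eq
  have hf0 := ne_zero_of_normalized hF.normalized
  have hff0 := ne_zero_of_normalized hf.1
  set τ : LogSeries := X + C g with hτ
  have hq : ∀ k < P.natDegree, ∃ s : ℚ[X], s.natDegree ≤ k ∧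
      flagSol f k = C f₀ * eval₂ ratLog τ s := by
    intro k hk
    obtain ⟨s, hs, h1⟩ := hF.exists_eval₂ hP (k + 1) hk (flagSol f k)
      ((degree_le_of_natDegree_le (flagSol_natDegree_le f k)).trans_lt
        (by exact_mod_cast Nat.lt_succ_self k)) (hf.2 k hk)
    exact ⟨s, natDegree_le_iff_coeff_eq_zero.2 fun j hj =>
      (degree_lt_iff_coeff_zero _ _).1 hs j hj, h1⟩
  have hlead : ∀ (s : ℚ[X]) (k : ℕ), s.natDegree ≤ k →
      (eval₂ ratLog τ s).coeff k = HahnSeries.C (s.coeff k) := by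
    intro s k hs
    rw [eval₂_eq_sum_range' _ (Nat.lt_succ_of_le hs), finsetSum_coeff,
      Finset.sum_range_succ, Finset.sum_eq_zero, zero_add]
    · have h1 : (τ ^ k).coeff k = 1 := by
        have := ((monic_X_add_C g).pow k).coeff_natDegree
        rwa [natDegree_pow, natDegree_X_add_C, mul_one] at this
      rw [RingHom.comp_apply, coeff_C_mul, h1, mul_one]
    · intro j hj
      rw [Finset.mem_range] at hj
      have h1 : (τ ^ j).natDegree < k := by
        rw [natDegree_pow, natDegree_X_add_C, mul_one]; exact hj
      rw [RingHom.comp_apply, coeff_C_mul, coeff_eq_zero_of_natDegree_lt h1, mul_zero]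
  obtain ⟨s0, hs0, hfs0⟩ := hq 0 (by omega)
  obtain ⟨c, rfl⟩ : ∃ c, s0 = C c := ⟨_, eq_C_of_natDegree_le_zero hs0⟩
  have hf00 : f 0 = HahnSeries.C c * f₀ := by
    have h1 := congrArg (fun x => coeff x 0) hfs0
    simp only [flagSol_coeff_self] at h1
    simpa [mul_comm] using h1
  have hc : c ≠ 0 := by
    rintro rfl
    rw [map_zero, zero_mul] at hf00
    exact hff0 hf00
  have hder : ∀ k < P.natDegree, ∃ s : ℚ[X], flagSol f k = C f₀ * eval₂ ratLog τ s ∧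
      derivative^[k] s = C c := by
    intro k hk
    obtain ⟨s, hs, hfs⟩ := hq k hk
    refine ⟨s, hfs, ?_⟩
    have h1 := congrArg (fun x => coeff x k) hfs
    simp only [flagSol_coeff_self, coeff_C_mul, hlead s k hs, hf00] at h1
    have h2 : HahnSeries.C (((k.factorial : ℚ)⁻¹) * c) = (HahnSeries.C (s.coeff k) :
        LaurentSeries ℚ) := by
      apply mul_left_cancel₀ hf0
      rw [← h1, map_mul]; ring
    have h3 : ((k.factorial : ℚ)⁻¹) * c = s.coeff k := HahnSeries.C_injective h2
    ext j
    rw [coeff_iterate_derivative]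
    rcases Nat.eq_zero_or_pos j with rfl | hj
    · rw [zero_add, Nat.descFactorial_self, ← h3, coeff_C_zero, nsmul_eq_mul, ← mul_assoc,
        mul_inv_cancel₀ (by exact_mod_cast k.factorial_ne_zero), one_mul]
    · rw [coeff_eq_zero_of_natDegree_lt (by omega), smul_zero, coeff_C, if_neg (by omega)]
  have hhh : (C h⁻¹ : LogSeries) * C h = 1 := by rw [← C_mul, inv_mul_cancel₀ hh0, C_1]
  have main : ∀ i, i + 1 < P.natDegree → (∀ s : ℚ[X],
      normalOp (flagSol f) (i + 1) (C f₀ * eval₂ ratLog τ s) =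
        C h * eval₂ ratLog τ (C c⁻¹ * derivative^[i + 1] s)) := by
    intro i hi
    induction i with
    | zero =>
      intro s
      change logTheta (Ring.inverse (flagSol f 0) * (C f₀ * eval₂ ratLog τ s)) = _
      have h0 : flagSol f 0 = C (HahnSeries.C c * f₀) := by
        rw [hfs0, eval₂_C, RingHom.comp_apply, C_mul]; ring
      have h0' : HahnSeries.C c * f₀ ≠ 0 := by rw [← hf00]; exact hff0
      rw [h0, ringInverse_C h0']
      have h1 : C (HahnSeries.C c * f₀)⁻¹ * (C f₀ * eval₂ ratLog τ s) =
          eval₂ ratLog τ (C c⁻¹ * s) := by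
        rw [eval₂_mul, eval₂_C, ← mul_assoc, ← C_mul, mul_inv, mul_assoc, inv_mul_cancel₀ hf0,
          mul_one, RingHom.comp_apply, map_inv₀ HahnSeries.C]
      rw [h1, logTheta_eval₂, hh, derivative_C_mul]
      simp [mul_comm]
    | succ i ih =>
      intro s
      specialize ih (by omega)
      change logTheta (Ring.inverse (normalOp (flagSol f) (i + 1) (flagSol f (i + 1))) *
        normalOp (flagSol f) (i + 1) (C f₀ * eval₂ ratLog τ s)) = _
      obtain ⟨t, ht, htd⟩ := hder (i + 1) (by omega)
      rw [ht, ih t, htd, ← C_mul, inv_mul_cancel₀ hc, C_1, eval₂_one, mul_one, ringInverse_C hh0,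
        ih s, ← mul_assoc, hhh, one_mul, logTheta_eval₂, hh, derivative_C_mul,
        ← Function.iterate_succ_apply' derivative]
      ring
  obtain ⟨t, ht, htd⟩ := hder (i + 1) hi
  rw [ht, main i hi t, htd, ← C_mul, inv_mul_cancel₀ hc, C_1, eval₂_one, mul_one, hh]

lemma IsFrame.isFlag (hF : IsFrame P α f₀ g) :
    IsFlag P fun m => HahnSeries.C ((m.factorial : ℚ)⁻¹) * (f₀ * g ^ m) := by
  refine ⟨?_, fun k hk => ?_⟩
  · obtain ⟨r, u, hu, h⟩ := hF.normalized
    exact ⟨r, u, hu, by simpa using h⟩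
  · have h1 : flagSol (fun m => HahnSeries.C ((m.factorial : ℚ)⁻¹) * (f₀ * g ^ m)) k =
        ratLog ((k.factorial : ℚ)⁻¹) * (C f₀ * (X + C g) ^ k) := by
      rw [flagSol, add_pow, Finset.mul_sum, Finset.mul_sum]
      refine Finset.sum_congr rfl fun j hj => ?_
      rw [Finset.mem_range, Nat.lt_succ_iff] at hj
      have h2 : ((j.factorial : ℚ)⁻¹) * (((k - j).factorial : ℚ)⁻¹) =
          ((k.factorial : ℚ)⁻¹) * (k.choose j : ℚ) := by
        have e1 : (j.factorial : ℚ) ≠ 0 := by exact_mod_cast j.factorial_ne_zero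
        have e2 : ((k - j).factorial : ℚ) ≠ 0 := by exact_mod_cast (k - j).factorial_ne_zero
        have e3 : (k.factorial : ℚ) ≠ 0 := by exact_mod_cast k.factorial_ne_zero
        have e4 : (k.choose j : ℚ) * j.factorial * (k - j).factorial = k.factorial := by
          exact_mod_cast Nat.choose_mul_factorial_mul_factorial hj
        field_simp
        rw [← e4]; ring
      have h3 := congrArg (fun x => (HahnSeries.C x : LaurentSeries ℚ)) h2
      simp only [map_mul, map_natCast] at h3
      rw [← HahnSeries.C_mul_eq_smul, ← C_mul_X_pow_eq_monomial, RingHom.comp_apply,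
        ← mul_assoc (HahnSeries.C _) (HahnSeries.C _), h3]
      simp only [C_mul, C_pow, map_natCast]
      ring
    rw [h1]
    have h4 := opEval_const_mul toLog isDer_logDeriv P (logDeriv_ratLog ((k.factorial : ℚ)⁻¹))
      (C f₀ * (X + C g) ^ k)
    rw [show opEval toLog logDeriv P (C f₀ * (X + C g) ^ k) = 0 from hF.sol k hk, mul_zero] at h4
    exact h4

/-- All structure series of an operator with a frame are equal to `α`. -/
lemma IsFrame.isStructureSeries_iff (hF : IsFrame P α f₀ g) (hP : P ≠ 0) {i : ℕ} (hi : 1 ≤ i)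
    (hid : i < P.natDegree) (β : PowerSeries ℚ) : IsStructureSeries P i β ↔ β = α := by
  obtain ⟨i, rfl⟩ : ∃ j, i = j + 1 := ⟨i - 1, by omega⟩
  constructor
  · rintro ⟨-, -, f, hf, h⟩
    rw [hF.normalOp_flagSol hP hf hid] at h
    have h1 := mul_right_cancel₀ (right_ne_zero_of_mul_eq_one h) (h.trans hF.theta.symm)
    exact HahnSeries.ofPowerSeries_injective (C_injective h1)
  · rintro rfl
    exact ⟨hi, hid, _, hF.isFlag, by rw [hF.normalOp_flagSol hP hF.isFlag hid]; exact hF.theta⟩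

lemma IsFrame.isSpecialCoordinate_iff (hF : IsFrame P α f₀ g) (hP : P ≠ 0)
    (hd : 2 ≤ P.natDegree) (q : PowerSeries ℚ) : IsSpecialCoordinate P q ↔
      PowerSeries.constantCoeff q = 0 ∧ PowerSeries.coeff 1 q = 1 ∧
        α * (PowerSeries.X * PowerSeries.derivative ℚ q) = q := by
  unfold IsSpecialCoordinate
  simp only [hF.isStructureSeries_iff hP le_rfl hd, exists_eq_left]

/-- The equation `α z q' = q` has at most one solution of the form `q = z + ⋯`. -/
lemma specialCoordinate_unique {α q s : PowerSeries ℚ}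
    (hq0 : PowerSeries.constantCoeff q = 0) (hq1 : PowerSeries.coeff 1 q = 1)
    (hq : α * (PowerSeries.X * PowerSeries.derivative ℚ q) = q)
    (hs0 : PowerSeries.constantCoeff s = 0) (hs1 : PowerSeries.coeff 1 s = 1)
    (hs : α * (PowerSeries.X * PowerSeries.derivative ℚ s) = s) : q = s := by
  have hX : ∀ (u : PowerSeries ℚ) (m : ℕ),
      PowerSeries.coeff m (PowerSeries.X * PowerSeries.derivative ℚ u) =
        m * PowerSeries.coeff m u := by
    intro u m
    rcases m with _ | m
    · simp
    · rw [PowerSeries.coeff_succ_X_mul, PowerSeries.coeff_derivative]; push_cast; ring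
  have hα : PowerSeries.constantCoeff α = 1 := by
    have h1 := congrArg (PowerSeries.coeff 1) hq
    rw [PowerSeries.coeff_mul, Finset.Nat.antidiagonal_succ] at h1
    simpa [hX, hq1] using h1
  rw [← sub_eq_zero]
  set e := q - s with he
  have heq : α * (PowerSeries.X * PowerSeries.derivative ℚ e) = e := by
    rw [he, map_sub, mul_sub, mul_sub, hq, hs]
  ext m
  rw [map_zero]
  induction m using Nat.strong_induction_on with
  | _ m ih =>
    rcases m with _ | _ | m
    · simp [he, hq0, hs0]
    · simp [he, hq1, hs1]
    · have h1 := congrArg (PowerSeries.coeff (m + 2)) heq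
      rw [PowerSeries.coeff_mul, Finset.sum_eq_single (0, m + 2), hX] at h1
      · simp only [PowerSeries.coeff_zero_eq_constantCoeff, hα, one_mul] at h1
        have h2 : ((m : ℚ) + 1) * PowerSeries.coeff (m + 2) e = 0 := by
          push_cast at h1; linear_combination h1
        exact (mul_eq_zero.1 h2).resolve_left (by positivity)
      · rintro ⟨i, j⟩ hij hne
        rw [Finset.HasAntidiagonal.mem_antidiagonal] at hij
        simp only at hij
        have : j < m + 2 := by
          by_contra h
          apply hne
          ext <;> simp only <;> omega
        simp only [hX, ih j this, mul_zero]
      · intro h; simp at h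

end Frames

/-! ### Exponents of symmetric powers -/

section Exponents

open Polynomial

/-- The linear map `Tʲ ↦ T (T - 1) ⋯ (T - j + 1)`. -/
def toPochhammer (c : ℚ[X]) : ℚ[X] := c.sum fun j a => C a * descPochhammer ℚ j

lemma toPochhammer_add (a b : ℚ[X]) :
    toPochhammer (a + b) = toPochhammer a + toPochhammer b := by
  unfold toPochhammer
  rw [sum_add_index] <;> simp [add_mul]

lemma toPochhammer_monomial (j : ℕ) (a : ℚ) :
    toPochhammer (monomial j a) = C a * descPochhammer ℚ j := by
  simp [toPochhammer, sum_monomial_index]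

lemma toPochhammer_C_mul (a : ℚ) (c : ℚ[X]) : toPochhammer (C a * c) = C a * toPochhammer c := by
  induction c using Polynomial.induction_on' with
  | add p q hp hq => rw [mul_add, toPochhammer_add, hp, hq, toPochhammer_add, mul_add]
  | monomial j b =>
    rw [C_mul_monomial, toPochhammer_monomial, toPochhammer_monomial, C_mul, mul_assoc]

lemma toPochhammer_step (i : ℕ) (c : ℚ[X]) :
    toPochhammer (X * c + X * derivative c + C (-(i : ℚ)) * c) =
      (X - C (i : ℚ)) * toPochhammer c := by
  induction c using Polynomial.induction_on' with
  | add p q hp hq =>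
    rw [toPochhammer_add p q, mul_add (X - C (i : ℚ)), ← hp, ← hq, ← toPochhammer_add,
      derivative_add]
    congr 1; ring
  | monomial j b =>
    have h : X * monomial j b + X * derivative (monomial j b) + C (-(i : ℚ)) * monomial j b =
        monomial (j + 1) b + C ((j : ℚ) - i) * monomial j b := by
      rw [derivative_monomial, X_mul_monomial, X_mul_monomial, C_mul_monomial, C_mul_monomial]
      rcases j with _ | j
      · simp
      · rw [Nat.add_sub_cancel, add_assoc, ← map_add]
        congr 2; ring
    rw [h, toPochhammer_add, toPochhammer_C_mul, toPochhammer_monomial, toPochhammer_monomial,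
      descPochhammer_succ_right]
    simp only [C_sub, map_natCast]
    ring

/-- The coefficient of `∂ʲ` in `T` has a pole at `0` of order at most `i - j`, and the indicial
polynomial formed with the coefficients at `z^(j - i)` is `I`. -/
def HasIndicial (T : DiffOp) (i : ℕ) (I : ℚ[X]) : Prop :=
  ∃ c : ℚ[X], (∀ j : ℕ, HasLowest (toLaurent (T.coeff j)) ((j : ℤ) - i) (c.coeff j)) ∧
    toPochhammer c = I

lemma HasIndicial.add {T U : DiffOp} {i : ℕ} {I J : ℚ[X]} (hT : HasIndicial T i I)
    (hU : HasIndicial U i J) : HasIndicial (T + U) i (I + J) := by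
  obtain ⟨c, hc, rfl⟩ := hT
  obtain ⟨e, he, rfl⟩ := hU
  refine ⟨c + e, fun j => ?_, toPochhammer_add c e⟩
  rw [coeff_add, coeff_add, map_add]
  exact (hc j).add (he j)

lemma HasIndicial.C_mul {T : DiffOp} {i e : ℕ} {I : ℚ[X]} (hT : HasIndicial T i I)
    {a : RatFunc ℚ} {b : ℚ} (ha : HasLowest (toLaurent a) (-(e : ℤ)) b) :
    HasIndicial (C a * T) (i + e) (C b * I) := by
  obtain ⟨c, hc, rfl⟩ := hT
  refine ⟨C b * c, fun j => ?_, toPochhammer_C_mul b c⟩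
  rw [coeff_C_mul, coeff_C_mul, map_mul]
  convert ha.mul (hc j) using 1
  push_cast; ring

lemma HasIndicial.derivMul {T : DiffOp} {i : ℕ} {I : ℚ[X]} (hT : HasIndicial T i I) :
    HasIndicial (derivMul ratDeriv T) (i + 1) ((X - C (i : ℚ)) * I) := by
  obtain ⟨c, hc, rfl⟩ := hT
  refine ⟨_, fun j => ?_, toPochhammer_step i c⟩
  rw [coeff_derivMul isDer_ratDeriv, map_add, toLaurent_ratDeriv]
  have h1 := (hc j).laurentDer
  rw [add_assoc, coeff_add]
  apply HasLowest.add
  · rcases j with _ | j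
    · simp only [mul_coeff_zero, coeff_X_zero, zero_mul, map_zero]
      exact ⟨fun m _ => rfl, rfl⟩
    · rw [coeff_X_mul, coeff_X_mul]
      convert hc j using 1
      push_cast; ring
  · convert h1 using 1
    · push_cast; ring
    · rw [coeff_add, coeff_C_mul]
      rcases j with _ | j
      · simp
      · rw [coeff_X_mul, coeff_derivative]; push_cast; ring

lemma hasIndicial_symRec {p q : RatFunc ℚ} {p₁ q₂ : ℚ} (hp : HasLowest (toLaurent p) (-1) p₁)
    (hq : HasLowest (toLaurent q) (-2) q₂) (n i : ℕ) :
    HasIndicial (symRec ratDeriv p q n i) i (symRec (fun _ => 0) (p₁ - 1) q₂ n i) := by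
  have h0 : IsDer (fun _ : ℚ => (0 : ℚ)) := ⟨by simp, by simp⟩
  have hconst : ∀ (c : ℚ) (f : LaurentSeries ℚ) (s : ℤ) (b : ℚ), HasLowest f s b →
      HasLowest (HahnSeries.C c * f) s (c * b) := by
    intro c f s b hf
    have hC : HasLowest (HahnSeries.C c) 0 c :=
      ⟨fun m hm => by rw [HahnSeries.C_apply, HahnSeries.coeff_single_of_ne hm.ne],
        by rw [HahnSeries.C_apply, HahnSeries.coeff_single_same]⟩
    simpa using hC.mul hf
  induction i using Nat.twoStepInduction with
  | zero =>
    refine ⟨1, fun j => ?_, ?_⟩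
    · simp only [symRec, coeff_one]
      split_ifs with h
      · subst h
        rw [map_one]
        exact ⟨fun m hm => by
          rw [← HahnSeries.single_zero_one, HahnSeries.coeff_single_of_ne (by simp at hm; omega)],
          by simp⟩
      · rw [map_zero]; exact ⟨fun m _ => rfl, rfl⟩
    · rw [← monomial_zero_one, toPochhammer_monomial]; simp [symRec]
  | one =>
    refine ⟨X, fun j => ?_, ?_⟩
    · simp only [symRec, coeff_X]
      split_ifs with h
      · subst h
        rw [map_one]
        exact ⟨fun m hm => by
          rw [← HahnSeries.single_zero_one, HahnSeries.coeff_single_of_ne (by simp at hm; omega)],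
          by simp⟩
      · rw [map_zero]; exact ⟨fun m _ => rfl, rfl⟩
    · rw [← monomial_one_one_eq_X, toPochhammer_monomial]; simp [symRec]
  | more i ih0 ih1 =>
    have hnat : ∀ m : ℕ, toLaurent (m : RatFunc ℚ) = HahnSeries.C (m : ℚ) := by
      intro m; rw [map_natCast, map_natCast]
    have e1 : HasLowest (toLaurent (((i + 1 : ℕ) : RatFunc ℚ) * p)) (-((1 : ℕ) : ℤ))
        (((i + 1 : ℕ) : ℚ) * p₁) := by
      rw [map_mul, hnat]; exact hconst _ _ _ _ hp
    have e2 : HasLowest (toLaurent (((i + 1 : ℕ) : RatFunc ℚ) * ((n : RatFunc ℚ) - i) * q))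
        (-((2 : ℕ) : ℤ)) (((i + 1 : ℕ) : ℚ) * ((n : ℚ) - i) * q₂) := by
      rw [map_mul, map_mul, map_sub, hnat, hnat, hnat, mul_assoc, mul_assoc, ← map_sub]
      exact hconst _ _ _ _ (hconst _ _ _ _ hq)
    have h := (ih1.derivMul.add (ih1.C_mul e1)).add (ih0.C_mul e2)
    rw [symRec_succ_succ, symRec_succ_succ]
    have hd : ∀ Q : ℚ[X], derivMul (fun _ => 0) Q = X * Q := by
      intro Q; ext j; rw [coeff_derivMul h0, add_zero]
    convert h using 1
    rw [hd]
    simp only [map_mul, map_sub, map_natCast, C_1]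
    ring

/-- The symmetric power of the operator `(ϑ - r)²` with constant coefficients is
`(ϑ - n r)ⁿ⁺¹`. Write `ϑ - n r` as differentiation with respect to `s = ln z`, acting on the factor
`sⁿ` of `zⁿʳ sⁿ`; then the `i`-th operator maps `sⁿ` to a multiple of `sⁿ⁻ⁱ (1 + r s)ⁱ`. -/
lemma symRec_const (r : ℚ) (n : ℕ) :
    symRec (fun _ => 0) (-(2 * r)) (r ^ 2) n (n + 1) = (X - C (n * r)) ^ (n + 1) := by
  have h0 : IsDer (fun _ : ℚ => (0 : ℚ)) := ⟨by simp, by simp⟩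
  have hd : ∀ Q : ℚ[X], derivMul (fun _ => 0) Q = X * Q := by
    intro Q; ext j; rw [coeff_derivMul h0, add_zero]
  set J := symRec (fun _ : ℚ => (0 : ℚ)) (-(2 * r)) (r ^ 2) n with hJ
  set E : Module.End ℚ ℚ[X] := algebraMap ℚ _ (n * r) + derivative with hE
  have hEa : ∀ x, E x = C (n * r) * x + derivative x := by
    intro x
    rw [hE, LinearMap.add_apply, Module.algebraMap_end_apply, smul_eq_C_mul]
  have key : ∀ i, i ≤ n + 1 → aeval E (J i) (X ^ n) =
      (n.descFactorial i : ℚ[X]) * X ^ (n - i) * (1 + C r * X) ^ i := by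
    intro i
    induction i using Nat.twoStepInduction with
    | zero => intro _; simp [hJ, symRec]
    | one =>
      intro _
      simp only [hJ, symRec, aeval_X, hEa, derivative_X_pow]
      rcases n with _ | n
      · simp
      · simp only [Nat.add_sub_cancel, C_mul, map_natCast, Nat.descFactorial_one]
        ring
    | more i ih0 ih1 =>
      intro hi
      obtain ⟨m, hm⟩ : ∃ m, n = i + 1 + m := ⟨n - (i + 1), by omega⟩
      have hrec : J (i + 2) = X * J (i + 1) + C (((i + 1 : ℕ) : ℚ) * (-(2 * r))) * J (i + 1)
          + C (((i + 1 : ℕ) : ℚ) * ((n : ℚ) - i) * r ^ 2) * J i := by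
        rw [hJ, symRec_succ_succ, hd]
      rw [hrec, map_add, map_add, ← smul_eq_C_mul, ← smul_eq_C_mul, map_smul, map_smul,
        map_mul, aeval_X, LinearMap.add_apply, LinearMap.add_apply, LinearMap.smul_apply,
        LinearMap.smul_apply, Module.End.mul_apply, ih0 (by omega), ih1 (by omega),
        smul_eq_C_mul, smul_eq_C_mul, hEa]
      have e0 : n - i = m + 1 := by omega
      have e1 : n - (i + 1) = m := by omega
      have e2 : n - (i + 2) = m - 1 := by omega
      rw [Nat.descFactorial_succ _ (i + 1), Nat.descFactorial_succ _ i, e0, e1, e2]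
      set N : ℕ := n.descFactorial i
      have hn : (n : ℚ[X]) = i + 1 + m := by rw [hm]; push_cast; ring
      simp only [derivative_mul, derivative_natCast, derivative_pow, derivative_add,
        derivative_one, derivative_C, derivative_X, Nat.add_sub_cancel, C_mul,
        C_sub, C_pow, C_neg, map_natCast, C_ofNat, hn]
      rcases m with _ | m
      · push_cast; ring
      · simp only [Nat.add_sub_cancel]; push_cast; ring
  -- a polynomial of degree at most `n` in the derivation that kills `sⁿ` is zero
  have hzero : ∀ G : ℚ[X], G.natDegree ≤ n → aeval E G (X ^ n) = 0 → G = 0 := by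
    intro G hG h
    set H := G.comp (X + C (n * r)) with hH
    have hEH : aeval (derivative : Module.End ℚ ℚ[X]) H = aeval E G := by
      rw [hH, aeval_comp, map_add, aeval_X, aeval_C, add_comm]
    have hHd : H.natDegree ≤ n := by
      rw [hH, natDegree_comp, natDegree_X_add_C, mul_one]; exact hG
    have hH0 : H = 0 := by
      ext j
      rw [coeff_zero]
      rcases lt_or_ge n j with hj | hj
      · exact coeff_eq_zero_of_natDegree_lt (by omega)
      · rw [← hEH, aeval_eq_sum_range' (Nat.lt_succ_of_le hHd)] at h
        have h1 := congrArg (fun x => coeff x (n - j)) h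
        simp only [LinearMap.sum_apply, LinearMap.smul_apply, finsetSum_coeff, coeff_smul,
          Module.End.pow_apply, iterate_derivative_X_pow_eq_natCast_mul, coeff_zero,
          smul_eq_mul] at h1
        rw [Finset.sum_eq_single j] at h1
        · rw [← map_natCast (C : ℚ →+* ℚ[X]), coeff_C_mul, coeff_X_pow_self, mul_one] at h1
          refine (mul_eq_zero.1 h1).resolve_right ?_
          exact_mod_cast (Nat.descFactorial_pos.2 hj).ne'
        · intro b hb hne
          rw [Finset.mem_range] at hb
          rw [← map_natCast (C : ℚ →+* ℚ[X]), coeff_C_mul, coeff_X_pow, if_neg (by omega),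
            mul_zero, mul_zero]
        · intro hb; exact absurd (Finset.mem_range.2 (by omega)) hb
    have : G = H.comp (X - C (n * r)) := by
      rw [hH, comp_assoc]; simp
    rw [this, hH0, zero_comp]
  have hEX : aeval E (X - C ((n : ℚ) * r)) = derivative := by
    rw [map_sub, aeval_X, aeval_C, hE, add_sub_cancel_left]
  have hmon : (J (n + 1)).Monic := symRec_monic h0 _ _ _ _
  have hmon' : ((X - C ((n : ℚ) * r)) ^ (n + 1)).Monic := (monic_X_sub_C _).pow _
  have hdeg : (J (n + 1)).natDegree = n + 1 := symRec_natDegree h0 _ _ _ _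
  have hdeg' : ((X - C ((n : ℚ) * r)) ^ (n + 1)).natDegree = n + 1 := by
    rw [natDegree_pow, natDegree_X_sub_C, mul_one]
  rw [← sub_eq_zero]
  apply hzero
  · rw [natDegree_le_iff_coeff_eq_zero]
    intro j hj
    rw [coeff_sub]
    rcases (Nat.succ_le_of_lt hj).eq_or_lt with hj | hj
    · have h1 := hmon.coeff_natDegree
      have h2 := hmon'.coeff_natDegree
      rw [hdeg] at h1
      rw [hdeg'] at h2
      rw [← hj]
      change (J (n + 1)).coeff (n + 1) - _ = 0
      rw [h1]
      change 1 - coeff ((X - C ((n : ℚ) * r)) ^ (n + 1)) (n + 1) = 0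
      rw [h2, sub_self]
    · rw [coeff_eq_zero_of_natDegree_lt (by omega), coeff_eq_zero_of_natDegree_lt (by omega),
        sub_zero]
  · rw [map_sub, LinearMap.sub_apply, key _ le_rfl, Nat.descFactorial_of_lt (Nat.lt_succ_self n),
      map_pow (aeval E), hEX, Module.End.pow_apply,
      iterate_derivative_X_pow_eq_natCast_mul, Nat.descFactorial_of_lt (Nat.lt_succ_self n)]
    simp

/-- If all exponents of `L` are equal to `r`, then those of `Symⁿ(L)` are all equal to `n r`. -/
lemma symOp_exponents {L : DiffOp} (h2 : L.natDegree = 2) (hL : L.HasEqualIntegralExponents)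
    (n : ℕ) : (symOp L n).HasEqualIntegralExponents := by
  obtain ⟨hreg, r, hr⟩ := hL
  have hl : L.leadingCoeff ≠ 0 := leadingCoeff_ne_zero.2 (fun h => by rw [h] at h2; simp at h2)
  set p₁ := (L.monicCoeff 1).coeff (-1) with hp₁
  set q₂ := (L.monicCoeff 0).coeff (-2) with hq₂
  have hp : HasLowest (toLaurent (monicP L)) (-1) p₁ :=
    ⟨fun m hm => hreg 1 (by omega) m (by rw [h2]; push_cast; omega), rfl⟩
  have hq : HasLowest (toLaurent (monicQ L)) (-2) q₂ :=
    ⟨fun m hm => hreg 0 (by omega) m (by rw [h2]; push_cast; omega), rfl⟩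
  have hm2 : L.monicCoeff 2 = 1 := by
    rw [DiffOp.monicCoeff, ← h2, ← leadingCoeff, div_self hl, map_one]
  have hind : C q₂ + C p₁ * X + X * (X - 1) = (X - C (r : ℚ)) ^ 2 := by
    rw [← h2, ← hr, DiffOp.indicial, h2]
    simp only [Finset.sum_range_succ, Finset.sum_range_zero]
    rw [hm2]
    have e0 : (((0 : ℕ) : ℤ) - ((2 : ℕ) : ℤ)) = -2 := by norm_num
    have e1 : (((1 : ℕ) : ℤ) - ((2 : ℕ) : ℤ)) = -1 := by norm_num
    have e2 : (((2 : ℕ) : ℤ) - ((2 : ℕ) : ℤ)) = 0 := by norm_num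
    rw [e0, e1, e2, HahnSeries.coeff_one, if_pos rfl]
    rw [hp₁, hq₂]
    simp [descPochhammer_succ_right]
  have hq2 : q₂ = (r : ℚ) ^ 2 := by
    have := congrArg (eval 0) hind
    simpa using this
  have hp1 : p₁ - 1 = -(2 * (r : ℚ)) := by
    have := congrArg (eval 1) hind
    simp [hq2] at this
    linear_combination this
  obtain ⟨c, hc, hcI⟩ := hasIndicial_symRec hp hq n (n + 1)
  rw [hp1, hq2, symRec_const] at hcI
  have hmc : ∀ i, (symOp L n).monicCoeff i = toLaurent ((symOp L n).coeff i) := by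
    intro i; rw [DiffOp.monicCoeff, (symOp_monic L n).leadingCoeff, div_one]
  refine ⟨fun i _ m hm => ?_, n * r, ?_⟩
  · rw [hmc]
    rw [symOp_natDegree] at hm
    exact (hc i).1 m hm
  · rw [DiffOp.indicial, symOp_natDegree]
    push_cast
    rw [← hcI, toPochhammer, sum_over_range' _ _ (n + 2)]
    · refine Finset.sum_congr rfl fun i _ => ?_
      rw [hmc, ← (hc i).2]
      push_cast; rfl
    · rw [Nat.lt_succ_iff, natDegree_le_iff_coeff_eq_zero]
      intro j hj
      rw [← (hc j).2, coeff_eq_zero_of_natDegree_lt (by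
        rw [symRec_natDegree isDer_ratDeriv]; exact hj), map_zero, HahnSeries.coeff_zero]
    · simp

end Exponents

/-! ### Duality -/

section Duality

open Polynomial

/-- The action of an operator on `ℚ(z)`. -/
abbrev ratApply (P : DiffOp) (f : RatFunc ℚ) : RatFunc ℚ := opEval (RingHom.id _) ratDeriv P f

lemma ratApply_comp (P Q : DiffOp) (f : RatFunc ℚ) :
    ratApply (DiffOp.comp P Q) f = ratApply P (ratApply Q f) :=
  opEval_opMul (RingHom.id _) isDer_ratDeriv isDer_ratDeriv (fun _ => rfl) P Q f

lemma iterate_ratDeriv_X_pow (i j : ℕ) :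
    ratDeriv^[j] ((algebraMap ℚ[X] (RatFunc ℚ) X) ^ i) =
      (i.descFactorial j : RatFunc ℚ) * (algebraMap ℚ[X] (RatFunc ℚ) X) ^ (i - j) := by
  induction j with
  | zero => simp
  | succ j ih =>
    rw [Function.iterate_succ_apply', ih, isDer_ratDeriv.const_mul (isDer_ratDeriv.natCast _),
      Nat.descFactorial_succ]
    obtain h | ⟨m, hm⟩ : i - j = 0 ∨ ∃ m, i - j = m + 1 := by
      rcases h : i - j with _ | m
      · exact Or.inl rfl
      · exact Or.inr ⟨m, rfl⟩
    · rw [h, pow_zero, isDer_ratDeriv.one]; simp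
    · rw [hm, isDer_ratDeriv.pow_succ, ratDeriv_X, show i - (j + 1) = m by omega]
      push_cast; ring

/-- An operator is determined by its action on `ℚ(z)`. -/
lemma eq_zero_of_ratApply_eq_zero {P : DiffOp} (h : ∀ f, ratApply P f = 0) : P = 0 := by
  ext i
  rw [coeff_zero]
  induction i using Nat.strong_induction_on with
  | _ i ih =>
    have h1 := h ((algebraMap ℚ[X] (RatFunc ℚ) X) ^ i)
    rw [ratApply, opEval_eq_sum_range _ _ (m := P.natDegree + i + 1) (by omega),
      Finset.sum_eq_single i] at h1
    · rw [iterate_ratDeriv_X_pow, Nat.sub_self, pow_zero, mul_one, Nat.descFactorial_self] at h1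
      refine (mul_eq_zero.1 h1).resolve_right ?_
      exact_mod_cast i.factorial_ne_zero
    · intro j _ hj
      rcases lt_or_gt_of_ne hj with hj | hj
      · rw [ih j hj, map_zero, zero_mul]
      · rw [iterate_ratDeriv_X_pow, Nat.descFactorial_of_lt hj]; simp
    · intro hi; exact absurd (Finset.mem_range.2 (by omega)) hi

/-- The formal adjoint `f ↦ ∑ (-1)ⁱ (aᵢ f)⁽ⁱ⁾` of the action of `∑ aᵢ ∂ⁱ` on `ℚ(z)`. -/
def ratAdjoint (P : DiffOp) (f : RatFunc ℚ) : RatFunc ℚ :=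
  P.sum fun i a => (-1) ^ i * ratDeriv^[i] (a * f)

lemma ratAdjoint_monomial (i : ℕ) (a f : RatFunc ℚ) :
    ratAdjoint (monomial i a) f = (-1) ^ i * ratDeriv^[i] (a * f) := by
  rw [ratAdjoint, sum_monomial_index]
  have := isDer_ratDeriv.iterate_const_mul i isDer_ratDeriv.zero f
  rw [this]; simp

lemma ratAdjoint_add (P Q : DiffOp) (f : RatFunc ℚ) :
    ratAdjoint (P + Q) f = ratAdjoint P f + ratAdjoint Q f := by
  unfold ratAdjoint
  rw [sum_add_index]
  · intro i
    have := isDer_ratDeriv.iterate_const_mul i isDer_ratDeriv.zero f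
    rw [this]; simp
  · intro i a b
    rw [add_mul, isDer_ratDeriv.iterate_add, mul_add]

lemma ratAdjoint_apply_add (P : DiffOp) (f g : RatFunc ℚ) :
    ratAdjoint P (f + g) = ratAdjoint P f + ratAdjoint P g := by
  simp only [ratAdjoint, Polynomial.sum_def, mul_add, isDer_ratDeriv.iterate_add,
    Finset.sum_add_distrib]

lemma ratAdjoint_C_mul (a : RatFunc ℚ) (P : DiffOp) (f : RatFunc ℚ) :
    ratAdjoint (C a * P) f = ratAdjoint P (a * f) := by
  induction P using Polynomial.induction_on' with
  | add P Q hP hQ => rw [mul_add, ratAdjoint_add, ratAdjoint_add, hP, hQ]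
  | monomial i b =>
    rw [C_mul_monomial, ratAdjoint_monomial, ratAdjoint_monomial]
    congr 2; ring

lemma ratAdjoint_derivMul (P : DiffOp) (f : RatFunc ℚ) :
    ratAdjoint (derivMul ratDeriv P) f = -ratAdjoint P (ratDeriv f) := by
  induction P using Polynomial.induction_on' with
  | add P Q hP hQ => rw [derivMul_add isDer_ratDeriv, ratAdjoint_add, ratAdjoint_add, hP, hQ]; ring
  | monomial i b =>
    rw [derivMul_monomial isDer_ratDeriv, ratAdjoint_add, ratAdjoint_monomial,
      ratAdjoint_monomial, ratAdjoint_monomial, Function.iterate_succ_apply, isDer_ratDeriv.mul b f,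
      isDer_ratDeriv.iterate_add, mul_comm f]
    ring

lemma ratApply_dual (P : DiffOp) (f : RatFunc ℚ) :
    ratApply (DiffOp.dual P) f = (-1) ^ P.natDegree * ratAdjoint P f := by
  rw [DiffOp.dual, ratAdjoint, Polynomial.sum_def, Polynomial.sum_def, ratApply, opEval_sum,
    Finset.mul_sum]
  refine Finset.sum_congr rfl fun i _ => ?_
  have h1 : ((-1 : DiffOp) ^ (P.natDegree + i)) = C ((-1) ^ (P.natDegree + i)) := by simp
  have h2 := ratApply_comp (monomial i 1) (C (P.coeff i)) f
  rw [h1, opEval_C_mul]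
  change _ * ratApply _ f = _
  rw [h2, ratApply, opEval_monomial, ratApply, opEval_C]
  simp only [RingHom.id_apply]
  ring

/-- Self-duality, expressed by the action on `ℚ(z)`. -/
lemma comp_C_eq_iff (P : DiffOp) (α : RatFunc ℚ) :
    DiffOp.comp P (C α) = DiffOp.comp (C α) (DiffOp.dual P) ↔
      ∀ f, ratApply P (α * f) = α * ((-1) ^ P.natDegree * ratAdjoint P f) := by
  have h1 : ∀ f, ratApply (DiffOp.comp P (C α)) f = ratApply P (α * f) := by
    intro f; rw [ratApply_comp]; congr 1; exact opEval_C _ _ _ _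
  have h2 : ∀ f, ratApply (DiffOp.comp (C α) (DiffOp.dual P)) f =
      α * ((-1) ^ P.natDegree * ratAdjoint P f) := by
    intro f; rw [ratApply_comp, ← ratApply_dual]; exact opEval_C _ _ _ _
  constructor
  · intro h f; rw [← h1, h, h2]
  · intro h
    rw [← sub_eq_zero]
    apply eq_zero_of_ratApply_eq_zero
    intro f
    rw [ratApply, opEval_sub]
    change ratApply _ f - ratApply _ f = 0
    rw [h1, h2, h, sub_self]

/-- If `L` of order two is self-dual, its Wronskian is a rational function. -/
lemma exists_wronskian {L : DiffOp} (h2 : L.natDegree = 2) (hL : L.IsSelfDual) :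
    ∃ w : RatFunc ℚ, w ≠ 0 ∧ ratDeriv w = -(monicP L * w) := by
  obtain ⟨β, hβ, h⟩ := hL
  rw [comp_C_eq_iff, h2] at h
  set a := L.leadingCoeff with ha
  have ha0 : a ≠ 0 := leadingCoeff_ne_zero.2 (fun h => by rw [h] at h2; simp at h2)
  have hl2 : L.coeff 2 = a := by rw [ha, leadingCoeff, h2]
  have hev : ∀ f, a * ratDeriv (ratDeriv (β * f)) + L.coeff 1 * ratDeriv (β * f) +
      L.coeff 0 * (β * f) = β * (ratDeriv (ratDeriv (a * f)) - ratDeriv (L.coeff 1 * f) +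
        L.coeff 0 * f) := by
    intro f
    have h1 := h f
    rw [ratApply, opEval_eq_sum_range _ _ (m := 3) (by omega), ratAdjoint,
      sum_over_range' _ _ 3 (by omega)] at h1
    · simp only [Finset.sum_range_succ, Finset.sum_range_zero, hl2, RingHom.id_apply] at h1
      simp only [Function.iterate_succ_apply, Function.iterate_zero_apply] at h1
      linear_combination h1
    · intro i
      have := isDer_ratDeriv.iterate_const_mul i isDer_ratDeriv.zero f
      rw [this]; simp
  -- compare the coefficients of `f'` on both sides
  have h0 := hev 1
  have h1 := hev (algebraMap ℚ[X] (RatFunc ℚ) X)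
  have hx := ratDeriv_X
  set x := algebraMap ℚ[X] (RatFunc ℚ) X
  simp only [mul_one, isDer_ratDeriv.mul, isDer_ratDeriv.add, hx] at h0 h1
  have key : a * ratDeriv β + L.coeff 1 * β = β * ratDeriv a := by
    have h3 : (2 : RatFunc ℚ) * (a * ratDeriv β + L.coeff 1 * β) = 2 * (β * ratDeriv a) := by
      linear_combination h1 - x * h0
    exact mul_left_cancel₀ two_ne_zero h3
  refine ⟨β / a, div_ne_zero hβ ha0, ?_⟩
  have h4 : β = (β / a) * a := (div_mul_cancel₀ β ha0).symm
  have h5 := congrArg ratDeriv h4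
  rw [isDer_ratDeriv.mul] at h5
  have hp : monicP L * a = L.coeff 1 := div_mul_cancel₀ _ ha0
  apply mul_left_cancel₀ (mul_ne_zero ha0 ha0)
  set u := β / a
  linear_combination (-a) * h5 + key - (L.coeff 1 - ratDeriv a) * h4 + u * a * hp

/-- A continuant can be expanded from either end: the sequence `l` is built by multiplication on the
left, the sequence `r` by multiplication on the right with the same letters in reverse order. -/
lemma continuant_reverse {E : Type*} [Ring E] {n : ℕ} {a c l r : ℕ → E}
    (hl0 : l 0 = 1) (hl1 : l 1 = a 0) (hl : ∀ i, l (i + 2) = a (i + 1) * l (i + 1) + c i * l i)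
    (hr0 : r 0 = 1) (hr1 : r 1 = a n)
    (hr : ∀ i, i + 1 ≤ n → r (i + 2) = r (i + 1) * a (n - (i + 1)) + r i * c (n - 1 - i)) :
    l (n + 1) = r (n + 1) := by
  have key : ∀ k m, n = k + 1 + m → l (n + 1) = r (k + 1) * l (m + 1) + r k * c m * l m := by
    intro k
    induction k with
    | zero =>
      intro m hm
      obtain rfl : n = m + 1 := by omega
      rw [hl, hr0, hr1, one_mul]
    | succ k ih =>
      intro m hm
      rw [ih (m + 1) (by omega), hl, hr k (by omega), show n - (k + 1) = m + 1 by omega,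
        show n - 1 - k = m + 1 by omega]
      noncomm_ring
  rcases n with _ | n
  · rw [hl1, hr1]
  · rw [key n 0 (by omega), hr n (by omega), hl0, hl1]
    simp

/-- Symmetric powers of a self-dual operator of order two are self-dual. The operators `Lᵢ` form a
continuant with letters `∂ + i p`. The adjoint reverses the order of the letters, and conjugation
with `wⁿ`, where `w` is the Wronskian, turns the adjoint of `∂ + i p` into `-(∂ + (n - i) p)`. -/
lemma symOp_isSelfDual {L : DiffOp} (h2 : L.natDegree = 2) (hL : L.IsSelfDual) (n : ℕ) :
    (symOp L n).IsSelfDual := by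
  obtain ⟨w, hw0, hw⟩ := exists_wronskian h2 hL
  set p := monicP L
  set q := monicQ L
  have hα0 : w ^ n ≠ 0 := pow_ne_zero n hw0
  refine ⟨w ^ n, hα0, ?_⟩
  rw [comp_C_eq_iff, symOp_natDegree]
  set α := w ^ n with hα
  have hα' : ratDeriv α = -(n * p * α) := by
    rw [hα]
    rcases n with _ | n
    · simp [isDer_ratDeriv.one]
    · rw [isDer_ratDeriv.pow_succ, hw]; ring
  have hαi : ratDeriv α⁻¹ = n * p * α⁻¹ := by
    have h1 := congrArg ratDeriv (mul_inv_cancel₀ hα0)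
    rw [isDer_ratDeriv.mul, isDer_ratDeriv.one, hα'] at h1
    apply mul_left_cancel₀ hα0
    linear_combination h1
  set T := symRec ratDeriv p q n with hT
  -- multiplication by functions and `d/dz` as endomorphisms of the additive group of `ℚ(z)`
  let mulEnd : RatFunc ℚ → AddMonoid.End (RatFunc ℚ) := AddMonoidHom.mulLeft
  let derEnd : AddMonoid.End (RatFunc ℚ) := AddMonoidHom.mk' ratDeriv isDer_ratDeriv.add
  let l : ℕ → AddMonoid.End (RatFunc ℚ) := fun i =>
    AddMonoidHom.mk' (ratApply (T i)) (opEval_apply_add _ isDer_ratDeriv (T i))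
  let r : ℕ → AddMonoid.End (RatFunc ℚ) := fun i =>
    AddMonoidHom.mk' (fun f => (-1) ^ i * (α * ratAdjoint (T i) (α⁻¹ * f))) fun f g => by
      rw [mul_add, ratAdjoint_apply_add]; ring
  let a : ℕ → AddMonoid.End (RatFunc ℚ) := fun i => derEnd + mulEnd (i * p)
  let c : ℕ → AddMonoid.End (RatFunc ℚ) := fun i =>
    mulEnd (((i + 1 : ℕ) : RatFunc ℚ) * ((n : RatFunc ℚ) - i) * q)
  have hT0 : T 0 = monomial 0 1 := by rw [hT]; simp [symRec]
  have hT1 : T 1 = monomial 1 1 := by rw [hT]; simp [symRec, monomial_one_one_eq_X]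
  have key : l (n + 1) = r (n + 1) := by
    apply continuant_reverse (a := a) (c := c)
    · ext f
      change ratApply (T 0) f = f
      rw [ratApply, hT0, opEval_monomial]; simp
    · ext f
      change ratApply (T 1) f = ratDeriv f + ((0 : ℕ) : RatFunc ℚ) * p * f
      rw [ratApply, hT1, opEval_monomial]; simp
    · intro i
      ext f
      change ratApply (T (i + 2)) f = (ratDeriv (ratApply (T (i + 1)) f) +
        ((i + 1 : ℕ) : RatFunc ℚ) * p * ratApply (T (i + 1)) f) +
        ((i + 1 : ℕ) : RatFunc ℚ) * ((n : RatFunc ℚ) - i) * q * ratApply (T i) f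
      rw [ratApply, hT, symRec_succ_succ, opEval_add, opEval_add, opEval_C_mul, opEval_C_mul,
        opEval_derivMul _ isDer_ratDeriv isDer_ratDeriv (fun _ => rfl)]
      rfl
    · ext f
      change (-1) ^ 0 * (α * ratAdjoint (T 0) (α⁻¹ * f)) = f
      rw [hT0, ratAdjoint_monomial]
      simp only [pow_zero, one_mul, Function.iterate_zero_apply]
      rw [mul_inv_cancel_left₀ hα0]
    · ext f
      change (-1) ^ 1 * (α * ratAdjoint (T 1) (α⁻¹ * f)) = ratDeriv f + (n : RatFunc ℚ) * p * f
      rw [hT1, ratAdjoint_monomial, Function.iterate_one, one_mul, isDer_ratDeriv.mul, hαi]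
      have := mul_inv_cancel₀ hα0
      linear_combination (ratDeriv f + (n : RatFunc ℚ) * p * f) * this
    · intro i hi
      ext f
      change (-1) ^ (i + 2) * (α * ratAdjoint (T (i + 2)) (α⁻¹ * f)) =
        (-1) ^ (i + 1) * (α * ratAdjoint (T (i + 1))
          (α⁻¹ * (ratDeriv f + ((n - (i + 1) : ℕ) : RatFunc ℚ) * p * f))) +
        (-1) ^ i * (α * ratAdjoint (T i) (α⁻¹ * (((n - 1 - i + 1 : ℕ) : RatFunc ℚ) *
          ((n : RatFunc ℚ) - ((n - 1 - i : ℕ) : RatFunc ℚ)) * q * f)))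
      obtain ⟨m, hm⟩ : ∃ m, n = i + 1 + m := ⟨n - (i + 1), by omega⟩
      have e1 : n - (i + 1) = m := by omega
      have e2 : n - 1 - i = m := by omega
      have hn : (n : RatFunc ℚ) = i + 1 + m := by rw [hm]; push_cast; ring
      rw [e1, e2, hT, symRec_succ_succ, ratAdjoint_add, ratAdjoint_add, ratAdjoint_C_mul,
        ratAdjoint_C_mul, ratAdjoint_derivMul, isDer_ratDeriv.mul, hαi]
      have h3 : α⁻¹ * (ratDeriv f + (m : RatFunc ℚ) * p * f) =
          (α⁻¹ * ratDeriv f + f * ((n : RatFunc ℚ) * p * α⁻¹)) +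
            (-1) * (((i + 1 : ℕ) : RatFunc ℚ) * p * (α⁻¹ * f)) := by
        rw [hn]; push_cast; ring
      have h4 : α⁻¹ * (((m + 1 : ℕ) : RatFunc ℚ) * ((n : RatFunc ℚ) - (m : RatFunc ℚ)) * q * f) =
          ((i + 1 : ℕ) : RatFunc ℚ) * ((n : RatFunc ℚ) - i) * q * (α⁻¹ * f) := by
        rw [hn]; push_cast; ring
      have h5 : ∀ Q g, ratAdjoint Q (-1 * g) = -ratAdjoint Q g := by
        intro Q g
        rw [eq_neg_iff_add_eq_zero, ← ratAdjoint_apply_add, neg_one_mul, neg_add_cancel]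
        have := ratAdjoint_apply_add Q 0 0
        rwa [add_zero, left_eq_add] at this
      rw [h3, h4, ratAdjoint_apply_add _ _ (-1 * _), h5]
      ring
  intro f
  have h1 := DFunLike.congr_fun key (α * f)
  change ratApply (T (n + 1)) (α * f) =
    (-1) ^ (n + 1) * (α * ratAdjoint (T (n + 1)) (α⁻¹ * (α * f))) at h1
  rw [inv_mul_cancel_left₀ hα0] at h1
  change ratApply (T (n + 1)) (α * f) = α * ((-1) ^ (n + 1) * ratAdjoint (T (n + 1)) f)
  rw [h1]; ring

end Duality

/-! ### Irreducibility -/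

section Irreducible

open Polynomial

/-- If the logarithmic derivative of a solution of `L` in `ℚ((z))` is a rational function `s`, then
`∂ - s` is a right factor of `L`. -/
lemma not_isIrreducible_of_rational {L : DiffOp} (h2 : L.natDegree = 2) {f : LaurentSeries ℚ}
    (hf : f ≠ 0) (hsol : logApply L (C f) = 0) {s : RatFunc ℚ}
    (hs : laurentDer f = toLaurent s * f) : ¬ L.IsIrreducible := by
  intro hirr
  have hl : L.leadingCoeff ≠ 0 := leadingCoeff_ne_zero.2 (fun h => by rw [h] at h2; simp at h2)
  have hl2 : L.coeff 2 = L.leadingCoeff := by rw [leadingCoeff, h2]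
  have h1 := (logApply_eq_zero_iff h2 _).1 hsol
  have hric : ratDeriv s + s ^ 2 + monicP L * s + monicQ L = 0 := by
    apply toLaurent_injective
    apply mul_right_cancel₀ hf
    simp only [logDeriv_C, RingHom.comp_apply, ← C_mul, ← C_add, C_eq_zero] at h1
    rw [hs, isDer_laurentDer.mul, hs, ← toLaurent_ratDeriv] at h1
    simp only [map_add, map_mul, map_pow, map_zero]
    linear_combination h1
  have hfac : DiffOp.comp (C L.leadingCoeff * X + C (L.leadingCoeff * (monicP L + s))) (X - C s) =
      L := by
    rw [← sub_eq_zero]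
    apply eq_zero_of_ratApply_eq_zero
    intro g
    have hlin : ∀ g, ratApply (X - C s) g = ratDeriv g - s * g := by
      intro g
      rw [ratApply, opEval_sub, opEval_C, ← monomial_one_one_eq_X, opEval_monomial]; simp
    rw [ratApply, opEval_sub]
    change ratApply _ g - ratApply L g = 0
    rw [ratApply_comp, hlin, ratApply, opEval_add, opEval_C_mul, opEval_C,
      ← monomial_one_one_eq_X, opEval_monomial, ratApply, opEval_order_two _ _ h2]
    simp only [RingHom.id_apply, map_one, one_mul, Function.iterate_one, isDer_ratDeriv.sub,
      isDer_ratDeriv.mul]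
    linear_combination (-L.leadingCoeff * g) * hric
  rcases hirr.2 _ _ hfac with h | h
  · have h3 : (C L.leadingCoeff * X + C (L.leadingCoeff * (monicP L + s))).coeff 1 = 0 :=
      coeff_eq_zero_of_natDegree_lt (by rw [h]; exact one_pos)
    simp [coeff_C] at h3
    exact hl (leadingCoeff_eq_zero.2 h3)
  · rw [natDegree_X_sub_C] at h
    exact one_ne_zero h

/-- Let `B` be a monic operator of order `b + 1 ≤ n` that kills `f₀ⁿ τᵇ`, as a right factor of
`Symⁿ(L)` of this order does. Conjugation of `B` with a power of `f₀` gives an operator that kills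
`f₀ᵇ τᵇ`, which has degree `b` in `ln z`. So does `Symᵇ(L)`, and as the difference of the two has
order at most `b`, they are equal. Comparison of the coefficients of `∂ᵇ` shows that `f₀' / f₀` is
rational. -/
lemma exists_logDeriv_rational {L : DiffOp} (h2 : L.natDegree = 2) {f₀ g : LaurentSeries ℚ}
    (hf₀ : f₀ ≠ 0) (hsol : logApply L (C f₀ * (X + C g)) = 0) {n b : ℕ} (hbn : b + 1 ≤ n)
    {B : DiffOp} (hBd : B.natDegree = b + 1) (hBm : B.Monic)
    (hB : logApply B (C (f₀ ^ n) * (X + C g) ^ b) = 0) :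
    ∃ s : RatFunc ℚ, laurentDer f₀ = toLaurent s * f₀ := by
  obtain ⟨m, hm⟩ : ∃ m, n = b + m := ⟨n - b, by omega⟩
  have hm0 : m ≠ 0 := by omega
  set τ : LogSeries := X + C g with hτ
  -- `B₁ = B f₀ᵐ` kills `f₀ᵇ τᵇ`, as does `f₀ᵐ Symᵇ(L)`, which has the same leading coefficient
  set B₁ := opMul laurentDer (B.map toLaurent) (C (f₀ ^ m)) with hB₁
  have hBd' : (B.map toLaurent).natDegree = b + 1 := by rw [natDegree_map, hBd]
  obtain ⟨hd, hc1, hc0⟩ := opMul_C_coeff isDer_laurentDer hBd'.le (f₀ ^ m)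
  rw [← hB₁] at hd hc1 hc0
  have hBlead : B.coeff (b + 1) = 1 := by rw [← hBd]; exact hBm
  rw [coeff_map, hBlead, map_one, one_mul] at hc1
  rw [coeff_map, coeff_map, hBlead, map_one, one_mul] at hc0
  set S := symOp L b with hS
  have hSd : S.natDegree = b + 1 := symOp_natDegree L b
  have hSlead : S.coeff (b + 1) = 1 := by rw [← hSd]; exact symOp_monic L b
  set E := B₁ - C (f₀ ^ m) * S.map toLaurent with hE
  have hpow : (C (f₀ ^ b) * τ ^ b : LogSeries) = (C f₀ * τ) ^ b := by rw [mul_pow, C_pow]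
  have hEsol : lauApply E (C (f₀ ^ b) * τ ^ b) = 0 := by
    have h1 : lauApply B₁ (C (f₀ ^ b) * τ ^ b) = 0 := by
      rw [lauApply, hB₁, opEval_opMul C isDer_logDeriv isDer_laurentDer logDeriv_C, opEval_C,
        ← mul_assoc, ← C_mul, ← pow_add, add_comm m b, ← hm]
      rw [logApply_eq] at hB
      exact hB
    have h3 : lauApply (S.map toLaurent) (C (f₀ ^ b) * τ ^ b) = 0 := by
      rw [← logApply_eq, hpow]
      exact logApply_symRec_pow h2 hsol b
    rw [lauApply, hE, opEval_sub, opEval_C_mul]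
    change lauApply _ _ - _ * lauApply _ _ = 0
    rw [h1, h3, mul_zero, sub_zero]
  have hfτ : (C (f₀ ^ b) * τ ^ b : LogSeries).natDegree = b := by
    rw [natDegree_C_mul (pow_ne_zero b hf₀), natDegree_pow, natDegree_X_add_C, mul_one]
  have hne : (C (f₀ ^ b) * τ ^ b : LogSeries) ≠ 0 :=
    mul_ne_zero (by simpa using pow_ne_zero b hf₀) (pow_ne_zero b (X_add_C_ne_zero g))
  have hE0 : E = 0 := by
    by_contra h
    have h1 := natDegree_lt_of_lauApply_eq_zero h hne hEsol
    rw [hfτ] at h1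
    have h3 : E.natDegree ≤ b := by
      rw [natDegree_le_iff_coeff_eq_zero]
      intro j hj
      rw [hE, coeff_sub, coeff_C_mul, coeff_map]
      rcases (Nat.succ_le_of_lt hj).eq_or_lt with hj | hj
      · obtain rfl : j = b + 1 := hj.symm
        rw [hc1, hSlead, map_one, mul_one, sub_self]
      · rw [coeff_eq_zero_of_natDegree_lt (by omega), coeff_eq_zero_of_natDegree_lt (by omega),
          map_zero, mul_zero, sub_zero]
    omega
  have h1 : B₁.coeff b = f₀ ^ m * toLaurent (S.coeff b) := by
    have := congrArg (fun x => coeff x b) hE0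
    simp only [hE, coeff_sub, coeff_C_mul, coeff_map, coeff_zero] at this
    linear_combination this
  obtain ⟨m, rfl⟩ := Nat.exists_eq_succ_of_ne_zero hm0
  rw [hc0, Nat.succ_eq_add_one, isDer_laurentDer.pow_succ] at h1
  have hbm : (((b + 1 : ℕ) : RatFunc ℚ) * ((m + 1 : ℕ) : RatFunc ℚ)) ≠ 0 := by
    exact_mod_cast mul_ne_zero b.succ_ne_zero m.succ_ne_zero
  refine ⟨(S.coeff b - B.coeff b) / (((b + 1 : ℕ) : RatFunc ℚ) * ((m + 1 : ℕ) : RatFunc ℚ)), ?_⟩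
  have hbm' := (map_ne_zero_iff toLaurent toLaurent_injective).2 hbm
  rw [map_div₀, div_mul_eq_mul_div, eq_div_iff hbm']
  apply mul_left_cancel₀ (pow_ne_zero m hf₀)
  simp only [map_mul, map_sub, map_natCast]
  linear_combination h1

/-- If `Symⁿ(L) = A B` with `B` of order `b + 1`, the function `B(f₀ⁿ τⁿ)` is a solution of `A`, so
that its degree in `ln z` is less than the order of `A`. As operators commute with differentiation
with respect to `ln z`, it follows that `B` kills `f₀ⁿ τᵇ`. -/
lemma symOp_isIrreducible {L : DiffOp} (h2 : L.natDegree = 2) (hL : L.IsIrreducible)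
    {f₀ g : LaurentSeries ℚ} (hf₀ : f₀ ≠ 0) (hsol₀ : logApply L (C f₀) = 0)
    (hsol : logApply L (C f₀ * (X + C g)) = 0) (n : ℕ) : (symOp L n).IsIrreducible := by
  refine ⟨by rw [symOp_natDegree]; omega, fun A B hAB => ?_⟩
  by_contra! hcon
  obtain ⟨hA, hB⟩ := hcon
  have hA0 : A ≠ 0 := fun h => hA (by rw [h, natDegree_zero])
  have hB0 : B ≠ 0 := fun h => hB (by rw [h, natDegree_zero])
  have hdeg := opMul_natDegree isDer_ratDeriv hA0 hB0
  rw [show opMul ratDeriv A B = symOp L n from hAB, symOp_natDegree] at hdeg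
  obtain ⟨b, hb⟩ : ∃ b, B.natDegree = b + 1 := ⟨B.natDegree - 1, by omega⟩
  set τ : LogSeries := X + C g with hτ
  set Y : LogSeries := C (f₀ ^ n) * τ ^ n with hY
  have hYsol : logApply A (logApply B Y) = 0 := by
    rw [← logApply_comp, hAB, hY, C_pow, ← mul_pow]
    exact logApply_symRec_pow h2 hsol n
  have hBY : derivative^[A.natDegree] (logApply B Y) = 0 := by
    rcases eq_or_ne (logApply B Y) 0 with h | h
    · rw [h, iterate_derivative_zero]
    · exact iterate_derivative_eq_zero (natDegree_lt_of_logApply_eq_zero hA0 h hYsol)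
  have hBb : logApply B (C (f₀ ^ n) * τ ^ b) = 0 := by
    have := logApply_pow_eq_zero B (f₀ ^ n) g (by omega : A.natDegree ≤ n) hBY
    rwa [show n - A.natDegree = b by omega] at this
  -- pass to the monic operator with the same solutions
  have hl : B.leadingCoeff ≠ 0 := leadingCoeff_ne_zero.2 hB0
  obtain ⟨s, hs⟩ := exists_logDeriv_rational h2 hf₀ hsol (n := n) (b := b)
    (B := C B.leadingCoeff⁻¹ * B) (by omega)
    (by rw [natDegree_C_mul (inv_ne_zero hl), hb])
    (by rw [Monic, leadingCoeff_mul, leadingCoeff_C, inv_mul_cancel₀ hl])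
    (by
      have h1 := opEval_C_mul toLog logDeriv B.leadingCoeff⁻¹ B (C (f₀ ^ n) * τ ^ b)
      rw [show opEval toLog logDeriv B (C (f₀ ^ n) * τ ^ b) = 0 from hBb, mul_zero] at h1
      exact h1)
  exact not_isIrreducible_of_rational h2 hf₀ hsol₀ hs hL

end Irreducible

/-! ### Frames of CY-type operators of order two and of their symmetric powers -/

section CYType

open Polynomial

lemma NIntegral.mul {x y : PowerSeries ℚ} (hx : NIntegral x) (hy : NIntegral y) :
    NIntegral (x * y) := by
  obtain ⟨M, hM, hx⟩ := hx
  obtain ⟨N, hN, hy⟩ := hy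
  choose a ha using hx
  choose b hb using hy
  refine ⟨M * N, Nat.mul_pos hM hN, fun m =>
    ⟨∑ ij ∈ Finset.HasAntidiagonal.antidiagonal m, a ij.1 * N ^ ij.1 * (b ij.2 * M ^ ij.2), ?_⟩⟩
  rw [PowerSeries.coeff_mul, Finset.mul_sum, Int.cast_sum]
  refine Finset.sum_congr rfl fun ij hij => ?_
  rw [Finset.HasAntidiagonal.mem_antidiagonal] at hij
  push_cast
  rw [← ha, ← hb, ← hij]
  ring

lemma NIntegral.pow {x : PowerSeries ℚ} (hx : NIntegral x) (n : ℕ) : NIntegral (x ^ n) := by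
  induction n with
  | zero =>
    refine ⟨1, one_pos, fun m => ⟨if m = 0 then 1 else 0, ?_⟩⟩
    rw [pow_zero, PowerSeries.coeff_one]
    split_ifs <;> simp
  | succ n ih => rw [pow_succ]; exact ih.mul hx

lemma IsCYType.exists_isFrame {L : DiffOp} (hL : IsCYType L) (h2 : L.natDegree = 2) :
    ∃ (α : PowerSeries ℚ) (f₀ g : LaurentSeries ℚ), IsFrame L α f₀ g ∧ NIntegral α := by
  obtain ⟨α, ⟨-, -, f, hf, hα⟩, hN⟩ := hL.structureSeries 1 le_rfl (by omega)
  have hf0 := ne_zero_of_normalized hf.1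
  have hy0 : flagSol f 0 = C (f 0) := by simp [flagSol]
  have hy1 : flagSol f 1 = C (f 0) * (X + C (f 1 / f 0)) := by
    rw [mul_add, ← C_mul, mul_div_cancel₀ _ hf0, C_mul_X_eq_monomial]
    simp [flagSol, Finset.sum_range_succ, add_comm]
  refine ⟨α, f 0, f 1 / f 0, ⟨hL.exponents, hf.1, fun k hk => ?_, ?_⟩, hN⟩
  · obtain rfl | rfl : k = 0 ∨ k = 1 := by omega
    · rw [pow_zero, mul_one, ← hy0]; exact hf.2 0 hk
    · rw [pow_one, ← hy1]; exact hf.2 1 hk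
  · change C _ * logTheta (Ring.inverse (flagSol f 0) * flagSol f 1) = 1 at hα
    rwa [hy0, hy1, ringInverse_C hf0, ← mul_assoc, ← C_mul, inv_mul_cancel₀ hf0, C_1, one_mul]
      at hα

/-- The powers of `ln z + g` in a frame of `Symⁿ(L)` are the derivatives of `f₀ⁿ (ln z + g)ⁿ` with
respect to `ln z`. -/
lemma IsFrame.symOp {L : DiffOp} (h2 : L.natDegree = 2) {α : PowerSeries ℚ}
    {f₀ g : LaurentSeries ℚ} (hF : IsFrame L α f₀ g) (n : ℕ) :
    IsFrame (symOp L n) α (f₀ ^ n) g := by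
  refine ⟨symOp_exponents h2 hF.exponents n, ?_, fun k hk => ?_, hF.theta⟩
  · obtain ⟨r, u, hu, rfl⟩ := hF.normalized
    refine ⟨n • r, u ^ n, by rw [map_pow, hu, one_pow], ?_⟩
    rw [mul_pow, HahnSeries.single_pow, one_pow, map_pow]
  · rw [symOp_natDegree] at hk
    have h1 : logApply L (C f₀ * (X + C g)) = 0 := by
      have := hF.sol 1 (by omega)
      rwa [pow_one] at this
    have h3 := logApply_symRec_pow h2 h1 n
    rw [mul_pow, ← C_pow] at h3
    have h4 := logApply_pow_eq_zero (CalabiYauOp.symOp L n) (f₀ ^ n) g (Nat.sub_le n k)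
      (by rw [h3, iterate_derivative_zero])
    rwa [show n - (n - k) = k by omega] at h4

end CYType

end CalabiYauOp

end

theorem mainTheorem5 (L : CalabiYauOp.DiffOp) (hL : CalabiYauOp.IsCYType L)
    (h2 : L.natDegree = 2) (n : ℕ) :
    (CalabiYauOp.DiffOp.symPower n L).natDegree = n + 1 ∧
    CalabiYauOp.IsCYType (CalabiYauOp.DiffOp.symPower n L) ∧
    (∃ α : PowerSeries ℚ, ∀ i : ℕ, 1 ≤ i → i ≤ n → ∀ β : PowerSeries ℚ,
      CalabiYauOp.IsStructureSeries (CalabiYauOp.DiffOp.symPower n L) i β ↔ β = α) ∧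
    (1 ≤ n → ∃ q : PowerSeries ℚ,
      (∀ p : PowerSeries ℚ, CalabiYauOp.IsSpecialCoordinate L p ↔ p = q) ∧
      (∀ p : PowerSeries ℚ,
        CalabiYauOp.IsSpecialCoordinate (CalabiYauOp.DiffOp.symPower n L) p ↔ p = q)) := by
  open CalabiYauOp in
  obtain ⟨α, f₀, g, hF, hα⟩ := hL.exists_isFrame h2
  have hf₀ := ne_zero_of_normalized hF.normalized
  have hsol₀ : logApply L (Polynomial.C f₀) = 0 := by simpa using hF.sol 0 (by omega)
  have hsol : logApply L (Polynomial.C f₀ * (Polynomial.X + Polynomial.C g)) = 0 := by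
    simpa using hF.sol 1 (by omega)
  have hdeg : (Polynomial.C f₀ * (Polynomial.X + Polynomial.C g)).natDegree = 1 := by
    rw [Polynomial.natDegree_C_mul hf₀, Polynomial.natDegree_X_add_C]
  rw [symPower_eq h2 hsol hdeg n]
  have hL0 : L ≠ 0 := fun h => by rw [h] at h2; simp at h2
  have hS0 : symOp L n ≠ 0 := (symOp_monic L n).ne_zero
  have hS := hF.symOp h2 n
  have hSd := symOp_natDegree L n
  have hstr : ∀ i : ℕ, 1 ≤ i → i < (symOp L n).natDegree → ∀ β : PowerSeries ℚ,
      IsStructureSeries (symOp L n) i β ↔ β = α :=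
    fun i hi hid β => hS.isStructureSeries_iff hS0 hi hid β
  obtain ⟨q, hq, hqN⟩ := hL.specialCoordinate h2.ge
  have hcoordL := hF.isSpecialCoordinate_iff hL0 h2.ge
  have hq' := (hcoordL q).1 hq
  have hcoordS : 2 ≤ (symOp L n).natDegree → ∀ p,
      IsSpecialCoordinate (symOp L n) p ↔ IsSpecialCoordinate L p := fun h p => by
    rw [hS.isSpecialCoordinate_iff hS0 h, hcoordL]
  have huniq : ∀ p, IsSpecialCoordinate L p ↔ p = q := by
    intro p
    constructor
    · intro hp
      obtain ⟨h0, h1, h⟩ := (hcoordL p).1 hp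
      exact specialCoordinate_unique h0 h1 h hq'.1 hq'.2.1 hq'.2.2
    · rintro rfl; exact hq
  refine ⟨hSd, ?_, ⟨α, fun i hi hin => hstr i hi (by omega)⟩, fun hn => ⟨q, huniq, fun p => ?_⟩⟩
  · refine ⟨symOp_isIrreducible h2 hL.irreducible hf₀ hsol₀ hsol n,
      symOp_isSelfDual h2 hL.selfDual n, hS.exponents, ?_, fun h => ?_, fun i hi hid => ?_⟩
    · obtain ⟨y, hy0, hyN, hy⟩ := hL.solution
      refine ⟨y ^ n, pow_ne_zero n hy0, hyN.pow n, ?_⟩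
      rw [map_pow, map_pow]
      exact logApply_symRec_pow h2 hy n
    · exact ⟨q, (hcoordS h q).2 hq, hqN⟩
    · exact ⟨α, (hstr i hi hid α).2 rfl, hα⟩
  · rw [hcoordS (by omega), huniq]
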